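/- Let $d\ge 2$ and $k\ge 2$ be integers, and let $\mathbb S=\mathbb Z^2\times\{0,\dots,k-1\}^{d-2}$ with its nearest-neighbour edges (pairs of vertices at $\ell^1$-distance $1$). In Bernoulli bond percolation on $\mathbb S$ with parameter $p\in[0,1]$, each edge is independently open with probability $p$; write $\mathbb P_p$ for its law. Let $$p_c=\inf\{p\in[0,1]:\mathbb P_p[\text{the open connected component of }0\text{ in }\mathbb S\text{ is infinite}]>0\}$$ and $\mathbb P=\mathbb P_{p_c}$. For $A\subseteq\mathbb Z^2$ write $\overline A=A\times\{0,\dots,k-1\}^{d-2}$. For integers $m,n\ge 0$, let $B(m,n)=\overline{[0,m)\times[0,n)}$, and let $p(m,n)$ be the $\mathbb P$-probability that $\overline{\{0\}\times[0,n)}$ is connected to $\overline{\{m-1\}\times[0,n)}$ by an open path all of whose vertices lie in $B(m,n)$. Put $$C_*=\left(\frac{2}{\min(p_c,1-p_c)}\right)^{d\cdot 7^2\cdot k^{d-2}},\qquad c_*=\frac1{1+C_*}.$$ Then: 1. For all integers $m>n\ge 0$, $$p(2m-n,n)\ \ge\ \tfrac14\,c_*^{3}\,p(m,n)^4 .$$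 2. If $\liminf_{n\to\infty}p(\lfloor\rho n\rfloor,n)>0$ for some real $\rho>1$, then $\liminf_{n\to\infty}p(\lfloor\rho n\rfloor,n)>0$ for every real $\rho>1$. -/

import Mathlib

open MeasureTheory ProbabilityTheory

namespace SlabPercolation

/-- The vertices of the slab `ℤ² × {0, …, k-1}^(d-2)`; the first component is the projection
to `ℤ²`. -/
abbrev Slab (d k : ℕ) : Type := (ℤ × ℤ) × (Fin (d - 2) → Fin k)

/-- The `ℓ¹` distance inherited from `ℤ^d`. -/
def l1dist {d k : ℕ} (x y : Slab d k) : ℤ :=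
  |x.1.1 - y.1.1| + |x.1.2 - y.1.2| + ∑ i, |((x.2 i : ℕ) : ℤ) - ((y.2 i : ℕ) : ℤ)|

/-- The nearest-neighbour graph on the slab. -/
def slabGraph (d k : ℕ) : SimpleGraph (Slab d k) where
  Adj x y := l1dist x y = 1
  symm := ⟨fun x y h => by
    simpa only [l1dist, abs_sub_comm] using h⟩
  loopless := ⟨fun x h => by simp [l1dist] at h⟩

/-- Bond configurations: `true` means open, `false` means closed. -/
abbrev Config (d k : ℕ) : Type := (slabGraph d k).edgeSet → Bool

/-- Bernoulli bond percolation with parameter `p`: each edge is independently open with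
probability `p`. -/
noncomputable def bondMeasure (d k : ℕ) (p : unitInterval) : Measure (Config d k) :=
  Measure.infinitePi fun _ => bernoulliMeasure true false p

/-- The subgraph of open edges. -/
def openGraph {d k : ℕ} (ω : Config d k) : SimpleGraph (Slab d k) where
  Adj x y := ∃ h : (slabGraph d k).Adj x y, ω ⟨s(x, y), h⟩ = true
  symm := ⟨fun x y ⟨h, ho⟩ => ⟨h.symm, by
    have e : (⟨s(y, x), h.symm⟩ : (slabGraph d k).edgeSet) = ⟨s(x, y), h⟩ :=
      Subtype.ext Sym2.eq_swap
    rw [e]; exact ho⟩⟩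
  loopless := ⟨fun _ ⟨h, _⟩ => h.ne rfl⟩

/-- `X` is connected to `Y` by an open path all of whose vertices lie in `A`. -/
def ConnectedIn {d k : ℕ} (ω : Config d k) (X Y A : Set (Slab d k)) : Prop :=
  ∃ x ∈ X, ∃ y ∈ Y, ∃ γ : (openGraph ω).Walk x y, ∀ v ∈ γ.support, v ∈ A

/-- The set of vertices in the open connected component of `x`. -/
def cluster {d k : ℕ} (ω : Config d k) (x : Slab d k) : Set (Slab d k) :=
  {y | (openGraph ω).Reachable x y}

/-- The critical threshold for bond percolation on the slab. -/
noncomputable def pc (d k : ℕ) [NeZero k] : unitInterval :=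
  sInf {p | 0 < bondMeasure d k p {ω | (cluster ω 0).Infinite}}

/-- `overline A = A × {0, …, k-1}^(d-2)` for `A ⊆ ℤ²`. -/
def overline (d k : ℕ) (A : Set (ℤ × ℤ)) : Set (Slab d k) :=
  {x | x.1 ∈ A}

/-- `B(m,n)`, the lift of `[0,m) × [0,n)`. -/
def box (d k m n : ℕ) : Set (Slab d k) :=
  overline d k (Set.Ico 0 (m : ℤ) ×ˢ Set.Ico 0 (n : ℤ))

/-- `L(m,n)`, the lift of `{0} × [0,n)`. -/
def leftSide (d k n : ℕ) : Set (Slab d k) :=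
  overline d k ({0} ×ˢ Set.Ico 0 (n : ℤ))

/-- `R(m,n)`, the lift of `{m-1} × [0,n)`. -/
def rightSide (d k m n : ℕ) : Set (Slab d k) :=
  overline d k ({(m : ℤ) - 1} ×ˢ Set.Ico 0 (n : ℤ))

/-- The left-right crossing event `LR(m,n)`. -/
def LR (d k m n : ℕ) : Set (Config d k) :=
  {ω | ConnectedIn ω (leftSide d k n) (rightSide d k m n) (box d k m n)}

/-- The crossing probability `p(m,n)` at criticality. -/
noncomputable def crossProb (d k : ℕ) [NeZero k] (m n : ℕ) : ℝ :=
  (bondMeasure d k (pc d k)).real (LR d k m n)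

/-- The constant `C_*`. -/
noncomputable def CStar (d k : ℕ) [NeZero k] : ℝ :=
  (2 / min (pc d k : ℝ) (1 - (pc d k : ℝ))) ^ (d * 7 ^ 2 * k ^ (d - 2))

/-- The constant `c_*`. -/
noncomputable def cStar (d k : ℕ) [NeZero k] : ℝ :=
  1 / (1 + CStar d k)

end SlabPercolation

/-! In the plane, paths whose topology forces them to cross share a vertex. In a slab only their
projections to `ℤ²` are forced to meet, so two crossing paths may pass at different heights of a
common column. The substitute is the gluing inequality `glue`: under forced crossing, P(A ↔ B) P(C ↔
D) ≤ K P(A ↔ C), where K = 1 + 3 (2 / min(p, 1-p))^N and N bounds the number of edges touching a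
column.

By Harris, both connections occur together with at least the product probability. If A and C are
then not joined, `exists_joining_surgery` joins them by changing only edges that touch one column,
in such a way that the column can be read off the new configuration. The map is then at most
2^N-to-one and costs a factor at most min(p, 1-p)^(-N), which is `weightOf_le_of_surgery`. The
column is found through the lowest column of B reached from A ∪ C or, if only one cluster reaches
it, through the first path from there in a fixed enumeration; the surgery alters neither. The three
kinds of surgery give the factor 3. Forced crossing itself is proved by a parity (Jordan curve)
argument on projections.

Two gluings give the first claim. A left-right crossing of an m × n rectangle is glued to a path
from the bottom to the right half of the top of its last n × n square, giving p(m,n)²/2 ≤ K a, with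
a the probability that the left side is joined to that half-top. Gluing this connection to its
mirror image in the rectangle of length 2m - n gives a² ≤ K p(2m-n,n). Hence p(m,n)⁴/4 ≤ K³
p(2m-n,n), and K ≤ 1 + C_*. For the second claim, m = ⌊ρn⌋ almost doubles the excess ρ - 1, so
iteration together with monotonicity in the length reaches every aspect ratio. -/

namespace SlabPercolation

/-! ### Joining two clusters by a change at a single, recoverable column. -/

section Surgery

variable {V Q : Type*}

/-- The vertices joined by `H` to a vertex whose column lies in `A`. -/
def columnCluster (H : SimpleGraph V) (col : V → Q) (A : Set Q) : Set V :=
  {x | ∃ a, col a ∈ A ∧ H.Reachable a x}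

variable {H : SimpleGraph V} {col : V → Q} {A B C D : Set Q} {h : Q → ℕ} {enc : List V → ℕ}

lemma mem_columnCluster_of_reachable {x y : V} (hx : x ∈ columnCluster H col A)
    (r : H.Reachable x y) : y ∈ columnCluster H col A :=
  let ⟨a, ha, hr⟩ := hx
  ⟨a, ha, hr.trans r⟩

lemma mem_columnCluster_of_adj {x y : V} (hx : x ∈ columnCluster H col A) (r : H.Adj x y) :
    y ∈ columnCluster H col A :=
  mem_columnCluster_of_reachable hx r.reachable

lemma mem_columnCluster_of_col {x : V} (hx : col x ∈ A) : x ∈ columnCluster H col A :=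
  ⟨x, hx, .refl _⟩

lemma columnCluster_union :
    columnCluster H col (A ∪ C) = columnCluster H col A ∪ columnCluster H col C := by
  ext x
  constructor
  · rintro ⟨a, ha | ha, r⟩
    exacts [Or.inl ⟨a, ha, r⟩, Or.inr ⟨a, ha, r⟩]
  · rintro (⟨a, ha, r⟩ | ⟨a, ha, r⟩)
    exacts [⟨a, Or.inl ha, r⟩, ⟨a, Or.inr ha, r⟩]

/-- A set closed under adjacency and containing the columns of `A` contains their cluster. -/
lemma columnCluster_subset {W : Set V} (hA : ∀ x, col x ∈ A → x ∈ W)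
    (hW : ∀ x y, x ∈ W → H.Adj x y → y ∈ W) : columnCluster H col A ⊆ W := by
  rintro x ⟨a, ha, ⟨p⟩⟩
  have ha' := hA a ha
  by_contra hx
  obtain ⟨e, -, h1, h2⟩ := p.exists_boundary_dart W ha' hx
  exact h2 (hW _ _ h1 e.adj)

/-- `β` is the column of `B` of least height met by the cluster of `A`. -/
def IsLowestColumn (H : SimpleGraph V) (col : V → Q) (h : Q → ℕ) (A B : Set Q) (β : Q) : Prop :=
  β ∈ B ∧ (∃ x ∈ columnCluster H col A, col x = β) ∧
    ∀ x ∈ columnCluster H col A, col x ∈ B → h β ≤ h (col x)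

lemma IsLowestColumn.unique (hB : Set.InjOn h B) {β β' : Q} (h1 : IsLowestColumn H col h A B β)
    (h2 : IsLowestColumn H col h A B β') : β = β' := by
  obtain ⟨b1, ⟨x, hx, rfl⟩, m1⟩ := h1
  obtain ⟨b2, ⟨y, hy, rfl⟩, m2⟩ := h2
  exact hB b1 b2 (le_antisymm (m1 y hy b2) (m2 x hx b1))

lemma exists_isLowestColumn {x : V} (hx : x ∈ columnCluster H col A) (hxB : col x ∈ B) :
    ∃ β, IsLowestColumn H col h A B β := by
  classical
  have hne : ∃ n, ∃ y ∈ columnCluster H col A, col y ∈ B ∧ h (col y) = n := ⟨_, x, hx, hxB, rfl⟩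
  obtain ⟨y, hy, hyB, hn⟩ := Nat.find_spec hne
  exact ⟨col y, hyB, ⟨y, hy, rfl⟩, fun z hz hzB => hn ▸ Nat.find_min' hne ⟨z, hz, hzB, rfl⟩⟩

/-- Vertex lists of the simple paths of `H` from the column `β` to the columns of `A`. -/
def pathLists (H : SimpleGraph V) (col : V → Q) (A : Set Q) (β : Q) : Set (List V) :=
  {l | ∃ x y, ∃ p : H.Walk x y, p.IsPath ∧ col x = β ∧ col y ∈ A ∧ p.support = l}

/-- `l` is the first element of `pathLists` in the enumeration `enc`. -/
def IsFirstPath (H : SimpleGraph V) (col : V → Q) (enc : List V → ℕ) (A : Set Q) (β : Q)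
    (l : List V) : Prop :=
  l ∈ pathLists H col A β ∧ ∀ l' ∈ pathLists H col A β, enc l ≤ enc l'

lemma IsFirstPath.unique (henc : Function.Injective enc) {β : Q} {l l' : List V}
    (h1 : IsFirstPath H col enc A β l) (h2 : IsFirstPath H col enc A β l') : l = l' :=
  henc (le_antisymm (h1.2 _ h2.1) (h2.2 _ h1.1))

lemma exists_isFirstPath {β : Q} {x : V} (hx : x ∈ columnCluster H col A) (hxβ : col x = β) :
    ∃ l, IsFirstPath H col enc A β l := by
  classical
  obtain ⟨a, ha, ⟨p⟩⟩ := hx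
  have hne : ∃ n, ∃ l ∈ pathLists H col A β, enc l = n :=
    ⟨_, _, ⟨x, a, p.reverse.bypass, p.reverse.bypass_isPath, hxβ, ha, rfl⟩, rfl⟩
  obtain ⟨l, hl, hn⟩ := Nat.find_spec hne
  exact ⟨l, hl, fun z hz => hn ▸ Nat.find_min' hne ⟨z, hz, rfl⟩⟩

/-- `q` is the column of a vertex of the first path from the lowest column of `B` to `A`, from
which `C` is reached without meeting that path again. -/
def IsAttachColumn (H : SimpleGraph V) (col : V → Q) (h : Q → ℕ) (enc : List V → ℕ)
    (A B C : Set Q) (q : Q) : Prop :=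
  ∃ β l, IsLowestColumn H col h (A ∪ C) B β ∧ IsFirstPath H col enc A β l ∧
    ∃ x ∈ l, col x = q ∧ ∃ c, col c ∈ C ∧ ∃ p : H.Walk x c, ∀ v ∈ p.support, v ∈ l → v = x

variable {G : SimpleGraph V}

/-- If both clusters reach the lowest column of `B`, opening that column joins them. -/
theorem exists_surgery_of_common_column (hHG : H ≤ G)
    (hcol : ∀ x ∈ columnCluster H col (A ∪ C), ∀ y, col x = col y →
      ∃ p : G.Walk x y, ∀ v ∈ p.support, col v = col x)
    {β : Q} (hβ : IsLowestColumn H col h (A ∪ C) B β)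
    (hA : ∃ x ∈ columnCluster H col A, col x = β) (hC : ∃ x ∈ columnCluster H col C, col x = β) :
    ∃ H' ≤ G, (∀ x y, col x ≠ β → col y ≠ β → (H'.Adj x y ↔ H.Adj x y)) ∧
      (∃ a c, col a ∈ A ∧ col c ∈ C ∧ H'.Reachable a c) ∧
      IsLowestColumn H' col h (A ∪ C) B β := by
  classical
  set K := columnCluster H col (A ∪ C) with hK
  -- Opening the whole column could attach foreign clusters reaching lower columns of `B`. Closing
  -- the edges at vertices of column `β` outside `K` prevents this: the new cluster of `A ∪ C` stays
  -- within `K` and column `β`.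
  let H' : SimpleGraph V :=
    { Adj := fun x y => (H.Adj x y ∧ (col x = β → x ∈ K) ∧ (col y = β → y ∈ K)) ∨
        (G.Adj x y ∧ col x = β ∧ col y = β)
      symm := ⟨fun x y hxy => hxy.imp (fun e => ⟨e.1.symm, e.2.2, e.2.1⟩)
        fun e => ⟨e.1.symm, e.2.2, e.2.1⟩⟩
      loopless := ⟨fun x hxx => hxx.elim (fun e => e.1.ne rfl) fun e => e.1.ne rfl⟩ }
  have hmono : ∀ {x y}, x ∈ K → H.Reachable x y → H'.Reachable x y := by
    rintro x y hx ⟨p⟩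
    refine ⟨p.transfer H' fun e he => ?_⟩
    induction e with | h s t =>
    have hs := mem_columnCluster_of_reachable hx
      (p.takeUntil s (p.fst_mem_support_of_mem_edges he)).reachable
    have hst := p.adj_of_mem_edges he
    exact Or.inl ⟨hst, fun _ => hs, fun _ => mem_columnCluster_of_adj hs hst⟩
  have hmem : ∀ {x}, col x ∈ A ∪ C → x ∈ K := fun hx => mem_columnCluster_of_col hx
  obtain ⟨x, ⟨a, ha, rax⟩, hx⟩ := hA
  obtain ⟨y, ⟨c, hc, rcy⟩, hy⟩ := hC
  refine ⟨H', fun x y e => e.elim (fun e => hHG e.1) fun e => e.1, ?_, ?_, hβ.1, ?_, ?_⟩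
  · intro x y hx hy
    exact ⟨fun e => e.elim (fun e => e.1) fun e => (hx e.2.1).elim,
      fun e => Or.inl ⟨e, fun e => (hx e).elim, fun e => (hy e).elim⟩⟩
  · refine ⟨a, c, ha, hc, (hmono (hmem (Or.inl ha)) rax).trans
      (.trans ?_ (hmono (hmem (Or.inr hc)) rcy).symm)⟩
    obtain ⟨p, hp⟩ := hcol x ⟨a, Or.inl ha, rax⟩ y (hx.trans hy.symm)
    refine ⟨p.transfer H' fun e he => ?_⟩
    induction e with | h s t =>
    exact Or.inr ⟨p.adj_of_mem_edges he, (hp s (p.fst_mem_support_of_mem_edges he)).trans hx,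
      (hp t (p.snd_mem_support_of_mem_edges he)).trans hx⟩
  · exact ⟨x, ⟨a, Or.inl ha, hmono (hmem (Or.inl ha)) rax⟩, hx⟩
  · intro v hv hvB
    have hsub : columnCluster H' col (A ∪ C) ⊆ K ∪ {v | col v = β} := by
      refine columnCluster_subset (fun x hx => Or.inl (hmem hx)) ?_
      rintro s t hs (e | e)
      · rcases hs with hs | hs
        · exact Or.inl (mem_columnCluster_of_adj hs e.1)
        · exact Or.inl (mem_columnCluster_of_adj (e.2.1 hs) e.1)
      · exact Or.inr e.2.2
    rcases hsub hv with hv | hv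
    · exact hβ.2.2 v hv hvB
    · exact (congrArg h hv).ge

/-- A path whose ends lie outside `Y` avoids `Y` if the only edge at the boundary of `Y` is
`s(w, u)`. -/
lemma IsPath.avoids_of_unique_boundary_edge {Y : Set V} {u w x y : V}
    (hY : ∀ s t, s ∈ Y → t ∉ Y → H.Adj s t → s = w ∧ t = u) (p : H.Walk x y) (hp : p.IsPath)
    (hx : x ∉ Y) (hy : y ∉ Y) : ∀ v ∈ p.support, v ∉ Y := by
  classical
  intro v hv hvY
  obtain ⟨e, he, h1, h2⟩ := (p.takeUntil v hv).reverse.exists_boundary_dart Y hvY hx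
  obtain ⟨f, hf, h3, h4⟩ := (p.dropUntil v hv).exists_boundary_dart Y hvY hy
  -- A visit to `Y` enters and leaves through `u`, which would then occur both before and after `v`
  -- on a simple path.
  have hu1 : u ∈ (p.takeUntil v hv).support := by
    have := (p.takeUntil v hv).reverse.dart_snd_mem_support_of_mem_darts he
    rw [(hY _ _ h1 h2 e.adj).2] at this
    simpa using this
  have hu2 : u ∈ (p.dropUntil v hv).support := by
    have := (p.dropUntil v hv).dart_snd_mem_support_of_mem_darts hf
    rwa [(hY _ _ h3 h4 f.adj).2] at this
  have huv : u ≠ v := by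
    rintro rfl
    exact (hY _ _ h1 h2 e.adj).2 ▸ h2 <| hvY
  have hu3 : u ∈ (p.dropUntil v hv).support.tail := by
    rw [SimpleGraph.Walk.mem_support_iff] at hu2
    exact hu2.resolve_left huv
  have hnd := hp.support_nodup
  rw [← p.take_spec hv, SimpleGraph.Walk.support_append, List.nodup_append] at hnd
  exact hnd.2.2 u hu1 u hu3 rfl

/-- If only the cluster of `A` reaches the lowest column of `B` and every path from there to `A`
passes over the cluster of `C`, then the two can be joined by changing one column, which can be
recovered from the result. -/
theorem exists_surgery_of_path (henc : Function.Injective enc) (hB : Set.InjOn h B) (hHG : H ≤ G)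
    (hcol : ∀ x ∈ columnCluster H col (A ∪ C), ∀ y, col x = col y →
      ∃ p : G.Walk x y, ∀ v ∈ p.support, col v = col x)
    (hdisj : ∀ x ∈ columnCluster H col A, x ∉ columnCluster H col C)
    {β : Q} (hβ : IsLowestColumn H col h (A ∪ C) B β)
    (hA : ∃ x ∈ columnCluster H col A, col x = β) (hC : ∀ x ∈ columnCluster H col C, col x ≠ β)
    (hmeet : ∀ x y (p : H.Walk x y), col x = β → col y ∈ A →
      ∃ u ∈ p.support, ∃ v ∈ columnCluster H col C, col u = col v) :
    ∃ z, ∃ H' ≤ G, (∀ x y, col x ≠ z → col y ≠ z → (H'.Adj x y ↔ H.Adj x y)) ∧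
      (∃ a c, col a ∈ A ∧ col c ∈ C ∧ H'.Reachable a c) ∧
      ∀ z', IsAttachColumn H' col h enc A B C z' ↔ z' = z := by
  classical
  set KC := columnCluster H col C with hKC
  set KA := columnCluster H col A with hKA
  obtain ⟨x₀, hx₀, hx₀β⟩ := hA
  obtain ⟨l, hl⟩ := exists_isFirstPath (enc := enc) hx₀ hx₀β
  obtain ⟨b, a, γ, hγ, hbβ, ha, hγl⟩ := hl.1
  obtain ⟨u₀, hu₀, v₀, hv₀, huv₀⟩ := hmeet b a γ hbβ ha
  set z := col v₀ with hz
  have hγA : ∀ v ∈ l, v ∈ KA := by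
    intro v hv
    rw [← hγl] at hv
    exact ⟨a, ha, (γ.dropUntil v hv).reachable.symm⟩
  rw [hγl] at hu₀
  have hzA : z ∉ A := fun hh => hdisj v₀ (mem_columnCluster_of_col hh) hv₀
  have hzβ : z ≠ β := hC v₀ hv₀
  -- the part of the column joined to `KC` off the path
  let R : Set V := {x | ∃ v ∈ KC, ∃ p : G.Walk v x, ∀ s ∈ p.support, s ∉ l ∧ col s = z}
  have hRz : ∀ x ∈ R, col x = z := fun x ⟨_, _, p, hp⟩ => (hp x p.end_mem_support).2
  have hRl : ∀ x ∈ R, x ∉ l := fun x ⟨_, _, p, hp⟩ => (hp x p.end_mem_support).1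
  have hv₀R : v₀ ∈ R :=
    ⟨v₀, hv₀, .nil, by simpa using ⟨fun hh => hdisj v₀ (hγA _ hh) hv₀, rfl⟩⟩
  have hRadj : ∀ s t, s ∈ R → G.Adj s t → t ∉ l → col t = z → t ∈ R := by
    rintro s t ⟨v, hv, p, hp⟩ hst htl htz
    refine ⟨v, hv, p.concat hst, fun r hr => ?_⟩
    rw [SimpleGraph.Walk.support_concat, List.mem_append,
      List.mem_singleton] at hr
    rcases hr with hr | rfl
    exacts [hp r hr, ⟨htl, htz⟩]
  -- The column is connected, so some walk in it leads from `v₀` in `R` to `u₀` on the path. Since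
  -- `R` absorbs every off-path neighbour in the column, an exit from `R` lands on the path.
  obtain ⟨w, u, hwR, huR, hwu, huz⟩ : ∃ w u, w ∈ R ∧ u ∉ R ∧ G.Adj w u ∧ col u = z := by
    obtain ⟨p, hp⟩ := hcol v₀ (columnCluster_union (H := H) ▸ Or.inr hv₀) u₀ huv₀.symm
    obtain ⟨e, he, h1, h2⟩ := p.exists_boundary_dart R hv₀R fun hh => hRl _ hh hu₀
    exact ⟨e.fst, e.snd, h1, h2, e.adj, hp _ (p.dart_snd_mem_support_of_mem_darts he)⟩
  have hul : u ∈ l := by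
    by_contra hul
    exact huR (hRadj w u hwR hwu hul huz)
  -- `R` is opened internally, tied to the path by the single edge `s(u, w)`, and cut off from
  -- everything else that is not in `KC`.
  let H' : SimpleGraph V :=
    { Adj := fun x y => G.Adj x y ∧ ((x = u ∧ y = w) ∨ (x = w ∧ y = u) ∨ (x ∈ R ∧ y ∈ R) ∨
        (H.Adj x y ∧ (x ∈ R → x ∈ KC) ∧ (y ∈ R → y ∈ KC)))
      symm := ⟨by
        rintro x y ⟨h1, h2 | h2 | h2 | h2⟩
        · exact ⟨h1.symm, Or.inr (Or.inl ⟨h2.2, h2.1⟩)⟩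
        · exact ⟨h1.symm, Or.inl ⟨h2.2, h2.1⟩⟩
        · exact ⟨h1.symm, Or.inr (Or.inr (Or.inl ⟨h2.2, h2.1⟩))⟩
        · exact ⟨h1.symm, Or.inr (Or.inr (Or.inr ⟨h2.1.symm, h2.2.2, h2.2.1⟩))⟩⟩
      loopless := ⟨fun x hxx => hxx.1.ne rfl⟩ }
  have hH'G : H' ≤ G := fun x y e => e.1
  set Y : Set V := KC ∪ R with hY
  have hlY : ∀ v ∈ l, v ∉ Y := by
    rintro v hv (hv' | hv')
    exacts [hdisj v (hγA v hv) hv', hRl v hv' hv]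
  -- `s(w, u)` is a bridge between `Y` and its complement; recovery of the column rests on this.
  have hYb : ∀ s t, s ∈ Y → t ∉ Y → H'.Adj s t → s = w ∧ t = u := by
    rintro s t hs ht ⟨-, h2 | h2 | h2 | h2⟩
    · exact (hlY u hul (h2.1 ▸ hs)).elim
    · exact h2
    · exact (ht (Or.inr h2.2)).elim
    · have hs' : s ∈ KC := hs.elim id h2.2.1
      exact (ht (Or.inl (mem_columnCluster_of_adj hs' h2.1))).elim
  have hkeep : ∀ s t, s ∉ R → t ∉ R → H.Adj s t → H'.Adj s t := fun s t hs ht e =>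
    ⟨hHG e, Or.inr (Or.inr (Or.inr ⟨e, fun hh => (hs hh).elim, fun hh => (ht hh).elim⟩))⟩
  -- the path survives
  have hγ' : ∀ e ∈ γ.edges, e ∈ H'.edgeSet := by
    intro e he
    induction e with | h s t =>
    refine hkeep s t (fun hh => hRl s hh ?_) (fun hh => hRl t hh ?_) (γ.adj_of_mem_edges he)
    · exact hγl ▸ γ.fst_mem_support_of_mem_edges he
    · exact hγl ▸ γ.snd_mem_support_of_mem_edges he
  have hlmem : ∀ s t, s ∈ l → t ∈ l → H'.Reachable s t := by
    have hall : ∀ s ∈ l, H'.Reachable b s := by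
      intro s hs
      have hs' : s ∈ (γ.transfer H' hγ').support := by
        rw [SimpleGraph.Walk.support_transfer, hγl]; exact hs
      exact ((γ.transfer H' hγ').takeUntil s hs').reachable
    exact fun s t hs ht => (hall s hs).symm.trans (hall t ht)
  have hbl : b ∈ l := hγl ▸ γ.start_mem_support
  have hal : a ∈ l := hγl ▸ γ.end_mem_support
  -- the attached cluster
  have hKCr : ∀ v ∈ KC, ∃ c, col c ∈ C ∧ ∃ p : H'.Walk v c, ∀ s ∈ p.support, s ∈ Y := by
    rintro v ⟨c, hc, ⟨p⟩⟩
    have hpK : ∀ s ∈ p.support, s ∈ KC := fun s hs => ⟨c, hc, (p.takeUntil s hs).reachable⟩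
    refine ⟨c, hc, (p.transfer H' fun e he => ?_).reverse, fun s hs => ?_⟩
    · induction e with | h s t =>
      exact ⟨hHG (p.adj_of_mem_edges he), Or.inr (Or.inr (Or.inr ⟨p.adj_of_mem_edges he,
        fun _ => hpK s (p.fst_mem_support_of_mem_edges he),
        fun _ => hpK t (p.snd_mem_support_of_mem_edges he)⟩))⟩
    · rw [SimpleGraph.Walk.support_reverse, List.mem_reverse,
        SimpleGraph.Walk.support_transfer] at hs
      exact Or.inl (hpK s hs)
  have hRr : ∀ x ∈ R, ∃ c, col c ∈ C ∧ ∃ p : H'.Walk x c, ∀ s ∈ p.support, s ∈ Y := by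
    rintro x ⟨v, hv, p, hp⟩
    obtain ⟨c, hc, q, hq⟩ := hKCr v hv
    have hpR : ∀ s ∈ p.support, s ∈ R := fun s hs =>
      ⟨v, hv, p.takeUntil s hs, fun r hr => hp r (p.support_takeUntil_subset_support hs hr)⟩
    refine ⟨c, hc, (p.transfer H' fun e he => ?_).reverse.append q, fun s hs => ?_⟩
    · induction e with | h s t =>
      exact ⟨p.adj_of_mem_edges he, Or.inr (Or.inr (Or.inl
        ⟨hpR s (p.fst_mem_support_of_mem_edges he), hpR t (p.snd_mem_support_of_mem_edges he)⟩))⟩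
    · rw [SimpleGraph.Walk.mem_support_append_iff, SimpleGraph.Walk.support_reverse,
        List.mem_reverse, SimpleGraph.Walk.support_transfer] at hs
      exact hs.elim (fun hs => Or.inr (hpR s hs)) (hq s)
  have hattach : ∃ c, col c ∈ C ∧ ∃ p : H'.Walk u c, ∀ v ∈ p.support, v ∈ l → v = u := by
    obtain ⟨c, hc, p, hp⟩ := hRr w hwR
    refine ⟨c, hc, .cons (⟨hwu.symm, Or.inl ⟨rfl, rfl⟩⟩ : H'.Adj u w) p, fun v hv hvl => ?_⟩
    rw [SimpleGraph.Walk.support_cons, List.mem_cons] at hv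
    exact hv.resolve_right fun hv => hlY v hvl (hp v hv)
  have hcl : columnCluster H' col (A ∪ C) ⊆ columnCluster H col (A ∪ C) ∪ R := by
    rw [columnCluster_union (H := H)]
    refine columnCluster_subset (fun x hx => ?_) ?_
    · exact Or.inl (hx.imp mem_columnCluster_of_col mem_columnCluster_of_col)
    · rintro s t hs ⟨-, h2 | h2 | h2 | h2⟩
      · exact Or.inr (h2.2 ▸ hwR)
      · exact Or.inl (Or.inl (h2.2 ▸ hγA u hul))
      · exact Or.inr h2.2
      · have hs' : s ∈ KA ∪ KC := hs.elim id fun hh => Or.inr (h2.2.1 hh)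
        exact Or.inl (hs'.imp (fun e => mem_columnCluster_of_adj e h2.1)
          fun e => mem_columnCluster_of_adj e h2.1)
  have hβ' : IsLowestColumn H' col h (A ∪ C) B β := by
    refine ⟨hβ.1, ⟨b, ⟨a, Or.inl ha, hlmem a b hal hbl⟩, hbβ⟩, fun x hx hxB => ?_⟩
    rcases hcl hx with hx | hx
    · exact hβ.2.2 x hx hxB
    · have hv₀K : v₀ ∈ columnCluster H col (A ∪ C) := by
        rw [columnCluster_union]; exact Or.inr hv₀
      have hxz := hRz x hx
      rw [hxz] at hxB ⊢
      exact hβ.2.2 v₀ hv₀K hxB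
  -- Competing simple paths have both ends outside `Y`, so they cannot use the bridge and are
  -- already paths of `H`. No new candidate precedes `l`.
  have hl' : IsFirstPath H' col enc A β l := by
    refine ⟨⟨b, a, γ.transfer H' hγ', hγ.transfer hγ', hbβ, ha, by simpa using hγl⟩, ?_⟩
    rintro l' ⟨x, y, p, hp, hxβ, hyA, rfl⟩
    have hx : x ∉ Y := fun hh => hh.elim (fun hh => hC x hh hxβ)
      fun hh => hzβ ((hRz x hh).symm.trans hxβ)
    have hy : y ∉ Y := fun hh => hh.elim (hdisj y (mem_columnCluster_of_col hyA))
      fun hh => hzA (hRz y hh ▸ hyA)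
    have hav := IsPath.avoids_of_unique_boundary_edge hYb p hp hx hy
    have hpH : ∀ e ∈ p.edges, e ∈ H.edgeSet := by
      intro e he
      induction e with | h s t =>
      have hs := hav s (p.fst_mem_support_of_mem_edges he)
      have ht := hav t (p.snd_mem_support_of_mem_edges he)
      rcases (p.adj_of_mem_edges he).2 with h2 | h2 | h2 | h2
      · exact (ht (Or.inr (h2.2 ▸ hwR))).elim
      · exact (hs (Or.inr (h2.1 ▸ hwR))).elim
      · exact (hs (Or.inr h2.1)).elim
      · exact h2.1
    exact hl.2 _ ⟨x, y, p.transfer H hpH, hp.transfer hpH, hxβ, hyA, by simp⟩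
  refine ⟨z, H', hH'G, ?_, ?_, fun z' => ⟨?_, ?_⟩⟩
  · intro x y hx hy
    have hxR : x ∉ R := fun hh => hx (hRz x hh)
    have hyR : y ∉ R := fun hh => hy (hRz y hh)
    refine ⟨?_, hkeep x y hxR hyR⟩
    rintro ⟨-, h2 | h2 | h2 | h2⟩
    · exact (hx (h2.1 ▸ huz)).elim
    · exact (hy (h2.2 ▸ huz)).elim
    · exact (hxR h2.1).elim
    · exact h2.1
  · obtain ⟨c, hc, p, -⟩ := hattach
    exact ⟨a, c, ha, hc, (hlmem a u hal hul).trans p.reachable⟩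
  · rintro ⟨β₁, l₁, hβ₁, hl₁, x, hxl, rfl, c, hc, p, hp⟩
    obtain rfl := hβ₁.unique hB hβ'
    obtain rfl := hl₁.unique henc hl'
    -- Followed back from `c`, the walk leaves `Y` at `u`, which lies on `l`; a walk meeting `l`
    -- only at `x` therefore has `x = u`.
    obtain ⟨e, he, h1, h2⟩ := p.reverse.exists_boundary_dart Y
      (Or.inl (mem_columnCluster_of_col hc)) (hlY x hxl)
    have hu : e.snd = u := (hYb _ _ h1 h2 e.adj).2
    have hup := p.reverse.dart_snd_mem_support_of_mem_darts he
    rw [hu, SimpleGraph.Walk.support_reverse, List.mem_reverse] at hup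
    rw [← hp u hup hul, huz]
  · rintro rfl
    exact ⟨β, l, hβ', hl', u, hul, huz, hattach⟩

/-- The three ways of reading off the modified column, one for each kind of surgery. -/
def IsMarkedColumn (H : SimpleGraph V) (col : V → Q) (h : Q → ℕ) (enc : List V → ℕ)
    (A B C : Set Q) (i : Fin 3) (q : Q) : Prop :=
  (i = 0 ∧ IsLowestColumn H col h (A ∪ C) B q) ∨ (i = 1 ∧ IsAttachColumn H col h enc A B C q) ∨
    (i = 2 ∧ IsAttachColumn H col h enc C B A q)

/-- Disjoint clusters of `A` and `C`, one reaching `B` and the other `D`, can be joined by changing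
a single column that is determined by the result. -/
theorem exists_joining_surgery (henc : Function.Injective enc) (hB : Set.InjOn h B) (hHG : H ≤ G)
    (hcol : ∀ x ∈ columnCluster H col (A ∪ C), ∀ y, col x = col y →
      ∃ p : G.Walk x y, ∀ v ∈ p.support, col v = col x)
    (hcross : ∀ a b c e (p : G.Walk a b) (q : G.Walk c e), col a ∈ A → col b ∈ B → col c ∈ C →
      (col e ∈ D ∨ (col e ∈ B ∧ h (col e) < h (col b))) →
      ∃ u ∈ p.support, ∃ v ∈ q.support, col u = col v)
    (hAB : ∃ a b, col a ∈ A ∧ col b ∈ B ∧ H.Reachable a b)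
    (hCD : ∃ c e, col c ∈ C ∧ col e ∈ D ∧ H.Reachable c e)
    (hAC : ¬ ∃ a c, col a ∈ A ∧ col c ∈ C ∧ H.Reachable a c) :
    ∃ i z, ∃ H' ≤ G, (∀ x y, col x ≠ z → col y ≠ z → (H'.Adj x y ↔ H.Adj x y)) ∧
      (∃ a c, col a ∈ A ∧ col c ∈ C ∧ H'.Reachable a c) ∧
      ∀ z', IsMarkedColumn H' col h enc A B C i z' ↔ z' = z := by
  classical
  have hdisj : ∀ x ∈ columnCluster H col A, x ∉ columnCluster H col C :=
    fun x ⟨a, ha, ra⟩ ⟨c, hc, rc⟩ => hAC ⟨a, c, ha, hc, ra.trans rc.symm⟩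
  have hcross' : ∀ a b c e (p : H.Walk a b) (q : H.Walk c e), col a ∈ A → col b ∈ B → col c ∈ C →
      (col e ∈ D ∨ (col e ∈ B ∧ h (col e) < h (col b))) →
      ∃ u ∈ p.support, ∃ v ∈ q.support, col u = col v := by
    intro a b c e p q ha hb hc he
    simpa using hcross a b c e (p.mapLe hHG) (q.mapLe hHG) ha hb hc he
  obtain ⟨a, b, ha, hb, hab⟩ := hAB
  obtain ⟨c, e, hc, he, ⟨q⟩⟩ := hCD
  have hbA : b ∈ columnCluster H col A := ⟨a, ha, hab⟩
  have hbAC : b ∈ columnCluster H col (A ∪ C) := columnCluster_union (H := H) ▸ Or.inl hbA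
  obtain ⟨β, hβ⟩ := exists_isLowestColumn (h := h) hbAC hb
  by_cases hA : ∃ x ∈ columnCluster H col A, col x = β
  · by_cases hC : ∃ x ∈ columnCluster H col C, col x = β
    · obtain ⟨H', h1, h2, h3, h4⟩ := exists_surgery_of_common_column hHG hcol hβ hA hC
      exact ⟨0, β, H', h1, h2, h3, fun z' => by
        simpa [IsMarkedColumn] using ⟨fun h5 => h5.unique hB h4, fun h5 => h5 ▸ h4⟩⟩
    · push Not at hC
      obtain ⟨z, H', h1, h2, h3, h4⟩ := exists_surgery_of_path henc hB hHG hcol hdisj hβ hA hC (by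
        intro x y p hx hy
        obtain ⟨u, hu, v, hv, huv⟩ := hcross' y x c e p.reverse q hy (hx ▸ hβ.1) hc (Or.inl he)
        exact ⟨u, by simpa using hu, v, ⟨c, hc, (q.takeUntil v hv).reachable⟩, huv⟩)
      exact ⟨1, z, H', h1, h2, h3, fun z' => by simpa [IsMarkedColumn] using h4 z'⟩
  · have hC : ∃ x ∈ columnCluster H col C, col x = β := by
      obtain ⟨-, ⟨x, hx, hxβ⟩, -⟩ := hβ
      rw [columnCluster_union] at hx
      exact ⟨x, hx.resolve_left fun hx => hA ⟨x, hx, hxβ⟩, hxβ⟩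
    push Not at hA
    -- The cluster of `A` misses `β`, so it ends strictly higher at `b`. This is the second
    -- alternative of `hcross`: the path from `A` to `b` passes over every path from `C` to `β`, and
    -- the roles of `A` and `C` are exchanged.
    have hlt : h β < h (col b) := lt_of_le_of_ne (hβ.2.2 b hbAC hb)
      fun hh => hA b hbA (hB hb hβ.1 hh.symm)
    have hdisj' : ∀ x ∈ columnCluster H col C, x ∉ columnCluster H col A :=
      fun x hx hx' => hdisj x hx' hx
    obtain ⟨p⟩ := hab
    obtain ⟨z, H', h1, h2, ⟨c', a', hc', ha', r⟩, h4⟩ :=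
      exists_surgery_of_path henc hB hHG (Set.union_comm A C ▸ hcol) hdisj' (Set.union_comm A C ▸ hβ) hC hA (by
        intro x y q hx hy
        obtain ⟨u, hu, v, hv, huv⟩ := hcross' a b y x p q.reverse ha hb hy
          (Or.inr (by rw [hx]; exact ⟨hβ.1, hlt⟩))
        exact ⟨v, by simpa using hv, u, ⟨a, ha, (p.takeUntil u hu).reachable⟩, huv.symm⟩)
    exact ⟨2, z, H', h1, h2, ⟨a', c', ha', hc', r.symm⟩,
      fun z' => by simpa [IsMarkedColumn] using h4 z'⟩

end Surgery
end SlabPercolation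

namespace SlabPercolation

/-! ### Finite product measures: Harris inequality and the cost of surgery. -/

section Weights

variable {I Q : Type*} [Fintype I]

/-- The probability of a single configuration on finitely many edges. -/
def weight (p : ℝ) (η : I → Bool) : ℝ := ∏ e, if η e then p else 1 - p

open Classical in
/-- The probability of an event depending on finitely many edges. -/
noncomputable def weightOf (p : ℝ) (E : Set (I → Bool)) : ℝ := ∑ η with η ∈ E, weight p η

variable {p : ℝ}

lemma weight_nonneg (h0 : 0 ≤ p) (h1 : p ≤ 1) (η : I → Bool) : 0 ≤ weight p η :=
  Finset.prod_nonneg fun e _ => by split_ifs <;> linarith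

lemma weightOf_mono (h0 : 0 ≤ p) (h1 : p ≤ 1) {E F : Set (I → Bool)} (hEF : E ⊆ F) :
    weightOf p E ≤ weightOf p F := by
  classical
  exact Finset.sum_le_sum_of_subset_of_nonneg
    (fun η hη => by simp only [Finset.mem_filter_univ] at hη ⊢; exact hEF hη)
    fun _ _ _ => weight_nonneg h0 h1 _

lemma weightOf_union_le (h0 : 0 ≤ p) (h1 : p ≤ 1) (E F : Set (I → Bool)) :
    weightOf p (E ∪ F) ≤ weightOf p E + weightOf p F := by
  classical
  simp only [weightOf, Set.mem_union, Finset.filter_or]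
  rw [← Finset.sum_union_inter]
  exact le_add_of_nonneg_right (Finset.sum_nonneg fun _ _ => weight_nonneg h0 h1 _)

/-- The Harris inequality. -/
lemma weightOf_mul_le_weightOf_inter (h0 : 0 ≤ p) (h1 : p ≤ 1) {E F : Set (I → Bool)}
    (hE : IsUpperSet E) (hF : IsUpperSet F) :
    weightOf p E * weightOf p F ≤ weightOf p (E ∩ F) := by
  classical
  have hmono : ∀ {S : Set (I → Bool)}, IsUpperSet S →
      Monotone fun η => if η ∈ S then (1 : ℝ) else 0 := by
    intro S hS a b hab
    by_cases ha : a ∈ S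
    · simp [ha, hS hab ha]
    · simp only [ha, if_false]
      split_ifs <;> norm_num
  have hnn : ∀ S : Set (I → Bool), (0 : (I → Bool) → ℝ) ≤ fun η => if η ∈ S then (1 : ℝ) else 0 :=
    fun S η => by dsimp; split_ifs <;> norm_num
  -- The lattice condition holds with equality, edge by edge, for a product weight.
  have hsup : ∀ a b : I → Bool,
      weight p a * weight p b ≤ weight p (a ⊓ b) * weight p (a ⊔ b) := by
    intro a b
    simp only [weight, ← Finset.prod_mul_distrib]
    refine (Finset.prod_congr rfl fun e _ => ?_).le
    rcases ha : a e <;> rcases hb : b e <;> simp [ha, hb, mul_comm]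
  have hone : ∑ η : I → Bool, weight p η = 1 := by
    have := Finset.prod_univ_sum (fun _ : I => (Finset.univ : Finset Bool))
      (fun _ b => if b then p else 1 - p)
    simp only [Fintype.piFinset_univ] at this
    simp [weight, ← this]
  have := fkg (μ := weight p) (hμ₀ := fun η => weight_nonneg h0 h1 η) (hf₀ := hnn E)
    (hg₀ := hnn F) (hf := hmono hE) (hg := hmono hF) (hμ := hsup)
  rw [hone, one_mul] at this
  simpa [weightOf, Finset.sum_filter, ← ite_and, and_comm] using this

/-- Changing the state of the edges in `J` costs at most a factor `min p (1 - p)` per edge. -/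
lemma pow_mul_weight_le (h0 : 0 ≤ p) (h1 : p ≤ 1) {η η' : I → Bool} {J : Finset I}
    (hJ : ∀ e ∉ J, η e = η' e) : min p (1 - p) ^ J.card * weight p η ≤ weight p η' := by
  classical
  have hm : 0 ≤ min p (1 - p) := le_min h0 (by linarith)
  have hpow : min p (1 - p) ^ J.card = ∏ e : I, if e ∈ J then min p (1 - p) else 1 := by
    simp [Finset.prod_ite_mem]
  rw [hpow, weight, weight, ← Finset.prod_mul_distrib]
  refine Finset.prod_le_prod (fun e _ => ?_) fun e _ => ?_
  · refine mul_nonneg ?_ ?_ <;> split_ifs <;> linarith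
  · by_cases he : e ∈ J
    · have h3 : (if η e = true then p else 1 - p) ≤ 1 := by split_ifs <;> linarith
      have h4 : min p (1 - p) ≤ if η' e = true then p else 1 - p := by
        split_ifs
        exacts [min_le_left _ _, min_le_right _ _]
      simp only [he, if_true]
      exact (mul_le_of_le_one_right hm h3).trans h4
    · simp [he, hJ e he]

/-- If every configuration of `E` can be turned into one of `F` by changing the edges of a set
of size at most `N` that is determined by the result, then the weights compare. -/
theorem weightOf_le_of_surgery [Nonempty Q] (h0 : 0 < p) (h1 : p < 1) {E F : Set (I → Bool)}
    (mark : (I → Bool) → Q → Prop) (J : Q → Finset I) {N : ℕ} (hN : ∀ z, (J z).card ≤ N)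
    (hsur : ∀ η ∈ E, ∃ η' ∈ F, ∃ z, (∀ e ∉ J z, η e = η' e) ∧ ∀ z', mark η' z' ↔ z' = z) :
    weightOf p E ≤ (2 / min p (1 - p)) ^ N * weightOf p F := by
  classical
  have hm : 0 < min p (1 - p) := lt_min h0 (by linarith)
  have hm1 : min p (1 - p) ≤ 1 := (min_le_left _ _).trans h1.le
  have hsur' : ∀ η, ∃ η' z, η ∈ E → η' ∈ F ∧ (∀ e ∉ J z, η e = η' e) ∧
      ∀ z', mark η' z' ↔ z' = z := by
    intro η
    by_cases hη : η ∈ E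
    · obtain ⟨η', h1, z, h2⟩ := hsur η hη
      exact ⟨η', z, fun _ => ⟨h1, h2⟩⟩
    · exact ⟨η, Classical.arbitrary Q, fun hh => (hη hh).elim⟩
  choose g z hg using hsur'
  set m := min p (1 - p) with hmdef
  have hstep : ∀ η ∈ E, weight p η ≤ (1 / m) ^ N * weight p (g η) := by
    intro η hη
    have h2 := pow_mul_weight_le h0.le h1.le (hg η hη).2.1
    have hw := weight_nonneg h0.le h1.le η
    have h3 : m ^ N * weight p η ≤ weight p (g η) :=
      (mul_le_mul_of_nonneg_right (pow_le_pow_of_le_one hm.le hm1 (hN _)) hw).trans h2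
    rw [one_div, inv_pow, ← div_eq_inv_mul, le_div_iff₀ (pow_pos hm N), mul_comm]
    exact h3
  -- The image determines the column, so two preimages of `ζ` agree with it off the same `J (z η₀)`
  -- and differ only in the states of at most `N` edges.
  have hfib : ∀ ζ, ((Finset.univ.filter (· ∈ E)).filter fun η => g η = ζ).card ≤ 2 ^ N := by
    intro ζ
    obtain hemp | ⟨η₀, hη₀⟩ :=
      ((Finset.univ.filter (· ∈ E)).filter fun η => g η = ζ).eq_empty_or_nonempty
    · simp [hemp]
    have hmem : ∀ η ∈ (Finset.univ.filter (· ∈ E)).filter (fun η => g η = ζ),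
        ∀ e ∉ J (z η₀), η e = ζ e := by
      intro η hη
      simp only [Finset.mem_filter, Finset.mem_univ, true_and] at hη hη₀
      have hzz : z η = z η₀ := by
        refine ((hg η₀ hη₀.1).2.2 (z η)).1 ?_
        rw [hη₀.2, ← hη.2]
        exact ((hg η hη.1).2.2 _).2 rfl
      rw [← hzz, ← hη.2]
      exact (hg η hη.1).2.1
    calc _ ≤ (Finset.univ : Finset (J (z η₀) → Bool)).card := by
          refine Finset.card_le_card_of_injOn (fun η e => η e) (fun _ _ => Finset.mem_univ _) ?_
          intro η hη η' hη' heq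
          funext e
          by_cases he : e ∈ J (z η₀)
          · exact congrFun heq ⟨e, he⟩
          · rw [hmem η hη e he, hmem η' hη' e he]
      _ = 2 ^ (J (z η₀)).card := by simp
      _ ≤ 2 ^ N := Nat.pow_le_pow_right (by norm_num) (hN _)
  have hwn := weight_nonneg (I := I) h0.le h1.le
  have h1m : 0 ≤ (1 / m) ^ N := by positivity
  calc weightOf p E ≤ ∑ η with η ∈ E, (1 / m) ^ N * weight p (g η) :=
        Finset.sum_le_sum fun η hη => hstep η (by simpa using hη)
    _ = ∑ ζ with ζ ∈ F, ∑ η ∈ (Finset.univ.filter (· ∈ E)).filter (fun η => g η = ζ),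
          (1 / m) ^ N * weight p (g η) := by
        refine (Finset.sum_fiberwise_of_maps_to (fun η hη => ?_) _).symm
        simp only [Finset.mem_filter, Finset.mem_univ, true_and] at hη ⊢
        exact (hg η hη).1
    _ ≤ ∑ ζ with ζ ∈ F, (2 / m) ^ N * weight p ζ := by
        refine Finset.sum_le_sum fun ζ _ => ?_
        rw [Finset.sum_congr rfl fun η hη => by rw [(Finset.mem_filter.1 hη).2],
          Finset.sum_const, nsmul_eq_mul, ← mul_assoc]
        refine mul_le_mul_of_nonneg_right ?_ (hwn ζ)
        calc _ ≤ (2 : ℝ) ^ N * (1 / m) ^ N :=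
              mul_le_mul_of_nonneg_right (by exact_mod_cast hfib ζ) h1m
          _ = (2 / m) ^ N := by rw [← mul_pow]; ring_nf
    _ = (2 / m) ^ N * weightOf p F := by rw [weightOf, Finset.mul_sum]

end Weights
end SlabPercolation

namespace SlabPercolation

/-! ### Geometry of the slab and of its columns. -/

section Slab

variable {d k : ℕ}

/-- An edge of the slab either stays in its layer or stays in its column. -/
lemma slabGraph_adj_cases {x y : Slab d k} (hxy : (slabGraph d k).Adj x y) :
    (x.2 = y.2 ∧ |x.1.1 - y.1.1| + |x.1.2 - y.1.2| = 1) ∨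
      (x.1 = y.1 ∧ ∃ i, |((x.2 i : ℕ) : ℤ) - ((y.2 i : ℕ) : ℤ)| = 1 ∧
        ∀ j ≠ i, x.2 j = y.2 j) := by
  have hsum : |x.1.1 - y.1.1| + |x.1.2 - y.1.2| +
    ∑ i, |((x.2 i : ℕ) : ℤ) - ((y.2 i : ℕ) : ℤ)| = 1 := hxy
  have h1 := abs_nonneg (x.1.1 - y.1.1)
  have h2 := abs_nonneg (x.1.2 - y.1.2)
  have hnn : ∀ i ∈ Finset.univ, 0 ≤ |((x.2 i : ℕ) : ℤ) - ((y.2 i : ℕ) : ℤ)| :=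
    fun _ _ => abs_nonneg _
  have heq : ∀ i, |((x.2 i : ℕ) : ℤ) - ((y.2 i : ℕ) : ℤ)| = 0 → x.2 i = y.2 i := fun i hi =>
    Fin.ext (by rw [abs_eq_zero] at hi; omega)
  by_cases h0 : ∑ i, |((x.2 i : ℕ) : ℤ) - ((y.2 i : ℕ) : ℤ)| = 0
  · refine Or.inl ⟨funext fun i => heq i ?_, by omega⟩
    exact (Finset.sum_eq_zero_iff_of_nonneg hnn).1 h0 i (Finset.mem_univ i)
  · obtain ⟨i, -, hi⟩ := Finset.exists_ne_zero_of_sum_ne_zero h0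
    have hle : ∑ i, |((x.2 i : ℕ) : ℤ) - ((y.2 i : ℕ) : ℤ)| ≤ 1 := by omega
    have hi0 := abs_nonneg (((x.2 i : ℕ) : ℤ) - ((y.2 i : ℕ) : ℤ))
    have hs := Finset.add_sum_erase Finset.univ
      (fun i => |((x.2 i : ℕ) : ℤ) - ((y.2 i : ℕ) : ℤ)|) (Finset.mem_univ i)
    have hnn' : ∀ j ∈ Finset.univ.erase i, 0 ≤ |((x.2 j : ℕ) : ℤ) - ((y.2 j : ℕ) : ℤ)| :=
      fun _ _ => abs_nonneg _
    have hrest := Finset.sum_nonneg hnn'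
    refine Or.inr ⟨Prod.ext ?_ ?_, i, by omega, fun j hj => heq j ?_⟩
    · have : |x.1.1 - y.1.1| = 0 := by omega
      rw [abs_eq_zero] at this
      omega
    · have : |x.1.2 - y.1.2| = 0 := by omega
      rw [abs_eq_zero] at this
      omega
    · exact (Finset.sum_eq_zero_iff_of_nonneg hnn').1 (by omega) j
        (Finset.mem_erase.2 ⟨hj, Finset.mem_univ j⟩)

/-- The nearest-neighbour graph on the columns of `S`. -/
def slabWithin (d k : ℕ) (S : Set (ℤ × ℤ)) : SimpleGraph (Slab d k) where
  Adj x y := (slabGraph d k).Adj x y ∧ x.1 ∈ S ∧ y.1 ∈ S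
  symm := ⟨fun _ _ h => ⟨h.1.symm, h.2.2, h.2.1⟩⟩
  loopless := ⟨fun _ h => h.1.ne rfl⟩

/-- The graph of open edges on the columns of `S`. -/
def openWithin (ω : Config d k) (S : Set (ℤ × ℤ)) : SimpleGraph (Slab d k) where
  Adj x y := (openGraph ω).Adj x y ∧ x.1 ∈ S ∧ y.1 ∈ S
  symm := ⟨fun _ _ h => ⟨h.1.symm, h.2.2, h.2.1⟩⟩
  loopless := ⟨fun _ h => h.1.ne rfl⟩

lemma openWithin_le (ω : Config d k) (S : Set (ℤ × ℤ)) : openWithin ω S ≤ slabWithin d k S :=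
  fun _ _ ⟨⟨h, _⟩, h1, h2⟩ => ⟨h, h1, h2⟩

lemma connectedIn_overline_iff {ω : Config d k} {X Y S : Set (ℤ × ℤ)} (hX : X ⊆ S) :
    ConnectedIn ω (overline d k X) (overline d k Y) (overline d k S) ↔
      ∃ x y : Slab d k, x.1 ∈ X ∧ y.1 ∈ Y ∧ (openWithin ω S).Reachable x y := by
  constructor
  · rintro ⟨x, hx, y, hy, γ, hγ⟩
    refine ⟨x, y, hx, hy, ⟨γ.transfer _ fun e he => ?_⟩⟩
    induction e with | h s t =>
    exact ⟨γ.adj_of_mem_edges he, hγ s (γ.fst_mem_support_of_mem_edges he),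
      hγ t (γ.snd_mem_support_of_mem_edges he)⟩
  · rintro ⟨x, y, hx, hy, ⟨p⟩⟩
    refine ⟨x, hx, y, hy, p.mapLe (fun _ _ h => h.1 : openWithin ω S ≤ openGraph ω), fun v hv => ?_⟩
    have hv' : v ∈ p.support := by simpa using hv
    by_contra hvS
    obtain ⟨e, -, -, h2⟩ := (p.takeUntil v hv').exists_boundary_dart {w | w.1 ∈ S} (hX hx) hvS
    exact h2 e.adj.2.2

/-- Induction on the ℓ¹ distance within the column: moving one differing coordinate a unit towards
its target decreases it. This supplies the connectedness of columns that the surgery needs. -/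
lemma exists_walk_in_column {S : Set (ℤ × ℤ)} {x y : Slab d k} (hx : x.1 ∈ S) (hxy : x.1 = y.1) :
    ∃ p : (slabWithin d k S).Walk x y, ∀ v ∈ p.support, v.1 = x.1 := by
  rcases x with ⟨z, f⟩
  rcases y with ⟨z', g⟩
  obtain rfl : z = z' := hxy
  have key : ∀ n : ℕ, ∀ f : Fin (d - 2) → Fin k,
      (∑ i, |((f i : ℕ) : ℤ) - ((g i : ℕ) : ℤ)|).toNat = n →
      ∃ p : (slabWithin d k S).Walk (z, f) (z, g), ∀ v ∈ p.support, v.1 = z := by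
    intro n
    induction n using Nat.strong_induction_on with
    | _ n ih =>
    intro f hn
    by_cases hfg : f = g
    · subst hfg
      exact ⟨.nil, by simp⟩
    obtain ⟨i, hi⟩ := Function.ne_iff.1 hfg
    have hi' : (f i : ℕ) ≠ g i := fun hh => hi (Fin.ext hh)
    obtain ⟨c, hc1, hc2⟩ : ∃ c : Fin k, |((f i : ℕ) : ℤ) - ((c : ℕ) : ℤ)| = 1 ∧
        |((c : ℕ) : ℤ) - ((g i : ℕ) : ℤ)| < |((f i : ℕ) : ℤ) - ((g i : ℕ) : ℤ)| := by
      have hfk := (f i).isLt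
      have hgk := (g i).isLt
      rcases lt_or_gt_of_ne hi' with hlt | hlt
      · refine ⟨⟨f i + 1, by omega⟩, ?_, ?_⟩
        · simp
        · have e1 : |((f i + 1 : ℕ) : ℤ) - ((g i : ℕ) : ℤ)| = g i - (f i + 1) := by
            rw [abs_of_nonpos] <;> push_cast <;> omega
          have e2 : |((f i : ℕ) : ℤ) - ((g i : ℕ) : ℤ)| = g i - f i := by
            rw [abs_of_nonpos] <;> omega
          rw [e2]
          exact e1.trans_lt (by omega)
      · obtain ⟨b, hb⟩ : ∃ b, (f i : ℕ) = b + 1 := ⟨f i - 1, by omega⟩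
        refine ⟨⟨b, by omega⟩, ?_, ?_⟩
        · simp [hb]
        · have e1 : |(b : ℤ) - ((g i : ℕ) : ℤ)| = b - g i := by
            rw [abs_of_nonneg]; omega
          have e2 : |((f i : ℕ) : ℤ) - ((g i : ℕ) : ℤ)| = f i - g i := by
            rw [abs_of_nonneg]; omega
          rw [e2]
          exact e1.trans_lt (by omega)
    let f' := Function.update f i c
    have hadj : (slabWithin d k S).Adj (z, f) (z, f') := by
      refine ⟨?_, hx, hx⟩
      change l1dist _ _ = 1
      simp only [l1dist, sub_self, abs_zero, zero_add]
      rw [Finset.sum_eq_single i]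
      · simpa [f'] using hc1
      · intro j _ hj
        simp [f', Function.update_of_ne hj]
      · simp
    have hlt : (∑ j, |((f' j : ℕ) : ℤ) - ((g j : ℕ) : ℤ)|) <
        ∑ j, |((f j : ℕ) : ℤ) - ((g j : ℕ) : ℤ)| := by
      refine Finset.sum_lt_sum (fun j _ => ?_) ⟨i, Finset.mem_univ i, by simpa [f'] using hc2⟩
      by_cases hj : j = i
      · subst hj
        simpa [f'] using hc2.le
      · simp [f', Function.update_of_ne hj]
    have hnn : 0 ≤ ∑ j, |((f' j : ℕ) : ℤ) - ((g j : ℕ) : ℤ)| :=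
      Finset.sum_nonneg fun _ _ => abs_nonneg _
    obtain ⟨p, hp⟩ := ih _ (by omega) f' rfl
    refine ⟨.cons hadj p, fun v hv => ?_⟩
    rw [SimpleGraph.Walk.support_cons, List.mem_cons] at hv
    rcases hv with rfl | hv
    exacts [rfl, hp v hv]
  exact key _ f rfl

/-- The number of edges meeting a column, up to a crude bound. -/
def columnBound (d k : ℕ) : ℕ := k ^ (d - 2) * (9 + (d - 2) * 2)

lemma card_column_edges_le [NeZero k] (z : ℤ × ℤ) (J : Finset (slabGraph d k).edgeSet)
    (hJ : ∀ e ∈ J, ∃ v ∈ e.1, v.1 = z) : J.card ≤ columnBound d k := by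
  classical
  -- An edge at the column is coded by its height there and a move to the other end. The moves
  -- overcount: all nine planar offsets are allowed, and the coordinate shifts wrap around modulo
  -- `k`.
  let move : Slab d k → (Fin 3 × Fin 3) ⊕ (Fin (d - 2) × Bool) → Slab d k := fun x m =>
    match m with
    | .inl (a, b) => ((x.1.1 + (a : ℕ) - 1, x.1.2 + (b : ℕ) - 1), x.2)
    | .inr (i, true) => (x.1, Function.update x.2 i (x.2 i + 1))
    | .inr (i, false) => (x.1, Function.update x.2 i (x.2 i - 1))
  have hmove : ∀ x y : Slab d k, (slabGraph d k).Adj x y → ∃ m, move x m = y := by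
    rintro ⟨⟨x1, x2⟩, f⟩ ⟨⟨y1, y2⟩, g⟩ hxy
    rcases slabGraph_adj_cases hxy with ⟨h1, h2⟩ | ⟨h1, i, hi, hj⟩
    · simp only at h1 h2
      have ha : -1 ≤ x1 - y1 ∧ x1 - y1 ≤ 1 := abs_le.1 (by have := abs_nonneg (x2 - y2); omega)
      have hb : -1 ≤ x2 - y2 ∧ x2 - y2 ≤ 1 := abs_le.1 (by have := abs_nonneg (x1 - y1); omega)
      refine ⟨.inl (⟨(y1 - x1 + 1).toNat, by omega⟩, ⟨(y2 - x2 + 1).toNat, by omega⟩), ?_⟩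
      subst h1
      simp only [move, Prod.mk.injEq, and_true]
      omega
    · simp only at h1 hi hj
      have hupd : ∀ c, c = g i → Function.update f i c = g := by
        rintro c rfl
        funext j
        by_cases hji : j = i
        · subst hji; simp
        · rw [Function.update_of_ne hji, hj j hji]
      have hfk := (f i).isLt
      have hgk := (g i).isLt
      rcases abs_eq (by norm_num) |>.1 hi with hh | hh
      · refine ⟨.inr (i, false), Prod.ext h1 (hupd (f i - 1) ?_)⟩
        rw [sub_eq_iff_eq_add]
        refine Fin.ext ?_
        have hk1 : 1 % k = 1 := Nat.mod_eq_of_lt (by omega)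
        rw [Fin.val_add, Fin.val_one', hk1, Nat.mod_eq_of_lt (by omega)]
        omega
      · refine ⟨.inr (i, true), Prod.ext h1 (hupd (f i + 1) ?_)⟩
        refine Fin.ext ?_
        have hk1 : 1 % k = 1 := Nat.mod_eq_of_lt (by omega)
        rw [Fin.val_add, Fin.val_one', hk1, Nat.mod_eq_of_lt (by omega)]
        omega
  let F : (Fin (d - 2) → Fin k) × ((Fin 3 × Fin 3) ⊕ (Fin (d - 2) × Bool)) → Sym2 (Slab d k) :=
    fun q => s((z, q.1), move (z, q.1) q.2)
  have hsub : J.image Subtype.val ⊆ Finset.univ.image F := by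
    intro e he
    obtain ⟨⟨e, he'⟩, heJ, rfl⟩ := Finset.mem_image.1 he
    obtain ⟨v, hv, hvz⟩ := hJ _ heJ
    obtain ⟨w, hw⟩ := Sym2.mem_iff_exists.1 hv
    simp only at hw
    subst hw
    obtain ⟨m, hm⟩ := hmove v w he'
    refine Finset.mem_image.2 ⟨(v.2, m), Finset.mem_univ _, ?_⟩
    have hv2 : (z, v.2) = v := Prod.ext hvz.symm rfl
    simp only [F, hv2, hm]
  calc J.card = (J.image Subtype.val).card :=
        (Finset.card_image_of_injective _ Subtype.val_injective).symm
    _ ≤ (Finset.univ.image F).card := Finset.card_le_card hsub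
    _ ≤ Finset.univ.card := Finset.card_image_le
    _ = columnBound d k := by simp [columnBound]

end Slab
end SlabPercolation

namespace SlabPercolation

/-! ### The gluing inequality for connection events. -/

section Gluing

variable {d k : ℕ}

/-- The event that the columns of `X` are joined to those of `Y` inside the columns of `S`. -/
def joinEvent (d k : ℕ) (X Y S : Set (ℤ × ℤ)) : Set (Config d k) :=
  {ω | ConnectedIn ω (overline d k X) (overline d k Y) (overline d k S)}

/-- The extension of a configuration on `I` by closed edges. -/
def extendClosed (I : Finset (slabGraph d k).edgeSet) [DecidablePred (· ∈ I)] (η : I → Bool) :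
    Config d k :=
  fun e => if h : e ∈ I then η ⟨e, h⟩ else false

/-- The event `F` depends only on the edges in `I`. -/
def DependsOnlyOn (F : Set (Config d k)) (I : Finset (slabGraph d k).edgeSet) : Prop :=
  ∀ ω ω' : Config d k, (∀ e ∈ I, ω e = ω' e) → ω ∈ F → ω' ∈ F

instance (p : unitInterval) : IsProbabilityMeasure (bondMeasure d k p) := by
  unfold bondMeasure; infer_instance

lemma bondMeasure_real_eq_weightOf (p : unitInterval) (I : Finset (slabGraph d k).edgeSet)
    [DecidablePred (· ∈ I)] {F : Set (Config d k)} (hF : DependsOnlyOn F I) :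
    (bondMeasure d k p).real F = weightOf (p : ℝ) {η | extendClosed I η ∈ F} := by
  classical
  have hpre : F = I.restrict ⁻¹' {η | extendClosed I η ∈ F} := by
    ext ω
    have h1 : ∀ e ∈ I, ω e = extendClosed I (I.restrict ω) e := fun e he => by
      simp [extendClosed, he]
    exact ⟨hF _ _ h1, hF _ _ fun e he => (h1 e he).symm⟩
  have hmeas : ∀ s : Set (I → Bool), MeasurableSet s := fun s => s.toFinite.measurableSet
  conv_lhs => rw [hpre]
  rw [bondMeasure, ← map_measureReal_apply (Finset.measurable_restrict I) (hmeas _),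
    Measure.infinitePi_map_restrict, weightOf]
  have hset : {η : I → Bool | extendClosed I η ∈ F} =
      (Finset.univ.filter (· ∈ {η : I → Bool | extendClosed I η ∈ F}) : Finset _) := by
    ext η; simp
  conv_lhs => rw [hset]
  rw [← sum_measureReal_singleton]
  refine Finset.sum_congr rfl fun η _ => ?_
  rw [measureReal_def, Measure.pi_singleton, ENNReal.toReal_prod, weight]
  refine Finset.prod_congr rfl fun e _ => ?_
  rw [← measureReal_def, bernoulliMeasure_real_apply _ (MeasurableSet.singleton _)]
  rcases η e <;> simp

lemma finite_edgesWithin (S : Finset (ℤ × ℤ)) :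
    {e : (slabGraph d k).edgeSet | ∀ v ∈ e.1, v.1 ∈ S}.Finite := by
  classical
  have hV : {x : Slab d k | x.1 ∈ S}.Finite := by
    have : {x : Slab d k | x.1 ∈ S} = (S : Set (ℤ × ℤ)) ×ˢ Set.univ := by ext; simp
    rw [this]
    exact S.finite_toSet.prod Set.finite_univ
  refine Set.Finite.preimage Subtype.val_injective.injOn
    (s := {e : Sym2 (Slab d k) | ∀ v ∈ e, v.1 ∈ S}) ?_
  refine ((hV.prod hV).image fun q => s(q.1, q.2)).subset fun e he => ?_
  induction e with | h x y =>
  exact ⟨(x, y), ⟨he x (by simp), he y (by simp)⟩, rfl⟩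

/-- The edges inside the columns of `S`. -/
noncomputable def edgesWithin (d k : ℕ) (S : Finset (ℤ × ℤ)) :
    Finset (slabGraph d k).edgeSet := (finite_edgesWithin S).toFinset

lemma mem_edgesWithin {S : Finset (ℤ × ℤ)} {e : (slabGraph d k).edgeSet} :
    e ∈ edgesWithin d k S ↔ ∀ v ∈ e.1, v.1 ∈ S := by simp [edgesWithin]

lemma openWithin_le_of_le {ω ω' : Config d k} {S : Finset (ℤ × ℤ)}
    (h : ∀ e ∈ edgesWithin d k S, ω e = true → ω' e = true) :
    openWithin ω S ≤ openWithin ω' S := by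
  rintro x y ⟨⟨h1, h2⟩, hx, hy⟩
  refine ⟨⟨h1, h _ (mem_edgesWithin.2 fun v hv => ?_) h2⟩, hx, hy⟩
  rcases Sym2.mem_iff.1 hv with rfl | rfl
  exacts [hx, hy]

/-- This one-sided comparison yields both the monotonicity needed for Harris and the dependence on
finitely many edges. -/
lemma mem_joinEvent_of_le {ω ω' : Config d k} {S : Finset (ℤ × ℤ)} {X Y : Set (ℤ × ℤ)}
    (hX : X ⊆ S) (h : ∀ e ∈ edgesWithin d k S, ω e = true → ω' e = true)
    (hω : ω ∈ joinEvent d k X Y S) : ω' ∈ joinEvent d k X Y S := by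
  rw [joinEvent, Set.mem_ofPred_eq, connectedIn_overline_iff hX] at hω ⊢
  obtain ⟨x, y, hx, hy, r⟩ := hω
  exact ⟨x, y, hx, hy, r.mono (openWithin_le_of_le h)⟩

lemma joinEvent_dependsOnlyOn {S : Finset (ℤ × ℤ)} {X Y : Set (ℤ × ℤ)} (hX : X ⊆ S) :
    DependsOnlyOn (joinEvent d k X Y S) (edgesWithin d k S) :=
  fun _ _ h hω => mem_joinEvent_of_le hX (fun e he ho => h e he ▸ ho) hω

open Classical in
/-- The configuration on `I` whose open edges are those of `H`. -/
noncomputable def configOf (I : Finset (slabGraph d k).edgeSet) (H : SimpleGraph (Slab d k)) :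
    I → Bool := fun e => decide (e.1.1 ∈ H.edgeSet)

-- Surgery yields a graph; this identity turns that graph back into a configuration.
open Classical in
lemma openWithin_extendClosed_configOf {S : Finset (ℤ × ℤ)} {H : SimpleGraph (Slab d k)}
    (hH : H ≤ slabWithin d k S) :
    openWithin (extendClosed (edgesWithin d k S) (configOf (edgesWithin d k S) H)) S = H := by
  ext x y
  constructor
  · rintro ⟨⟨h1, h2⟩, hx, hy⟩
    by_cases he : (⟨s(x, y), h1⟩ : (slabGraph d k).edgeSet) ∈ edgesWithin d k S
    · simpa [extendClosed, he, configOf] using h2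
    · simp [extendClosed, he] at h2
  · intro h
    obtain ⟨h1, hx, hy⟩ := hH h
    have he : (⟨s(x, y), h1⟩ : (slabGraph d k).edgeSet) ∈ edgesWithin d k S := by
      refine mem_edgesWithin.2 fun v hv => ?_
      rcases Sym2.mem_iff.1 hv with rfl | rfl
      exacts [hx, hy]
    exact ⟨⟨h1, by simpa [extendClosed, he, configOf] using h⟩, hx, hy⟩

/-- Paths from `A` to `B` and from `C` to `D` inside `S` share a column, and so do paths from `A`
and from `C` to distinct columns of `B` if the former ends higher. -/
def ForcedCrossing (d k : ℕ) (S A B C D : Set (ℤ × ℤ)) (h : ℤ × ℤ → ℕ) : Prop :=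
  ∀ (a b c e : Slab d k) (p : (slabWithin d k S).Walk a b) (q : (slabWithin d k S).Walk c e),
    a.1 ∈ A → b.1 ∈ B → c.1 ∈ C → (e.1 ∈ D ∨ (e.1 ∈ B ∧ h e.1 < h b.1)) →
    ∃ u ∈ p.support, ∃ v ∈ q.support, u.1 = v.1

/-- The gluing lemma. -/
theorem glue [NeZero k] (p : unitInterval) (h0 : 0 < p) (h1 : p < 1)
    {S : Finset (ℤ × ℤ)} {A B C D : Set (ℤ × ℤ)} {h : ℤ × ℤ → ℕ} (hA : A ⊆ S) (hC : C ⊆ S)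
    (hB : Set.InjOn h B) (hcross : ForcedCrossing d k S A B C D h) :
    (bondMeasure d k p).real (joinEvent d k A B S) *
        (bondMeasure d k p).real (joinEvent d k C D S) ≤
      (1 + 3 * (2 / min (p : ℝ) (1 - p)) ^ columnBound d k) *
        (bondMeasure d k p).real (joinEvent d k A C S) := by
  classical
  have hp0 : (0 : ℝ) < p := h0
  have hp1 : (p : ℝ) < 1 := h1
  set I := edgesWithin d k S with hI
  rw [bondMeasure_real_eq_weightOf p I (joinEvent_dependsOnlyOn hA),
    bondMeasure_real_eq_weightOf p I (joinEvent_dependsOnlyOn hC),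
    bondMeasure_real_eq_weightOf p I (joinEvent_dependsOnlyOn hA)]
  set W : Set (ℤ × ℤ) → Set (ℤ × ℤ) → Set (I → Bool) :=
    fun X Y => {η | extendClosed I η ∈ joinEvent d k X Y S} with hW
  change weightOf (p : ℝ) (W A B) * weightOf (p : ℝ) (W C D) ≤ _ * weightOf (p : ℝ) (W A C)
  have hup : ∀ {X Y : Set (ℤ × ℤ)}, X ⊆ S → IsUpperSet (W X Y) := by
    intro X Y hX η η' hle hη
    refine mem_joinEvent_of_le hX (fun e he ho => ?_) hη
    have he' : e ∈ I := he
    simp only [extendClosed, he', dif_pos] at ho ⊢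
    have := hle ⟨e, he'⟩
    rw [ho] at this
    exact top_le_iff.1 this
  have hWiff : ∀ {X Y : Set (ℤ × ℤ)}, X ⊆ S → ∀ η, η ∈ W X Y ↔ ∃ x y : Slab d k, x.1 ∈ X ∧
      y.1 ∈ Y ∧ (openWithin (extendClosed I η) S).Reachable x y :=
    fun hX η => connectedIn_overline_iff hX
  refine (weightOf_mul_le_weightOf_inter hp0.le hp1.le (hup hA) (hup hC)).trans ?_
  obtain ⟨enc, henc⟩ := exists_injective_nat (List (Slab d k))
  let mark : Fin 3 → (I → Bool) → ℤ × ℤ → Prop := fun i η z =>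
    IsMarkedColumn (openWithin (extendClosed I η) S) Prod.fst h enc A B C i z
  let J : ℤ × ℤ → Finset I := fun z => Finset.univ.filter fun e => ∃ v ∈ e.1.1, v.1 = z
  have hJ : ∀ z, (J z).card ≤ columnBound d k := by
    intro z
    rw [← Finset.card_map (Function.Embedding.subtype (· ∈ I))]
    refine card_column_edges_le z _ fun e he => ?_
    obtain ⟨e', he', rfl⟩ := Finset.mem_map.1 he
    exact (Finset.mem_filter.1 he').2
  -- One class for each rule for reading off the column: within a class the marked column is a
  -- function of the image.
  let E : Fin 3 → Set (I → Bool) := fun i => {η | ∃ η' ∈ W A C, ∃ z,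
    (∀ e ∉ J z, η e = η' e) ∧ ∀ z', mark i η' z' ↔ z' = z}
  have hE : ∀ i, weightOf (p : ℝ) (E i) ≤
      (2 / min (p : ℝ) (1 - p)) ^ columnBound d k * weightOf (p : ℝ) (W A C) :=
    fun i => weightOf_le_of_surgery hp0 hp1 (mark i) J hJ fun η hη => hη
  have hcover : W A B ∩ W C D ⊆ W A C ∪ (E 0 ∪ (E 1 ∪ E 2)) := by
    rintro η ⟨hAB, hCD⟩
    by_cases hAC : η ∈ W A C
    · exact Or.inl hAC
    right
    rw [hWiff hA] at hAB hAC
    rw [hWiff hC] at hCD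
    set H := openWithin (extendClosed I η) (S : Set (ℤ × ℤ)) with hH
    have hHG : H ≤ slabWithin d k S := openWithin_le _ _
    have hcl : columnCluster H Prod.fst (A ∪ C) ⊆ {x | x.1 ∈ S} :=
      columnCluster_subset (fun x hx => hx.elim (fun hh => hA hh) fun hh => hC hh)
        fun x y _ hxy => hxy.2.2
    obtain ⟨i, z, H', hH'G, hoff, hjoin, hmark⟩ := exists_joining_surgery henc hB hHG
      (fun x hx y hxy => exists_walk_in_column (hcl hx) hxy) hcross hAB hCD hAC
    have hHo : openWithin (extendClosed I (configOf I H')) (S : Set (ℤ × ℤ)) = H' :=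
      openWithin_extendClosed_configOf hH'G
    have hηE : η ∈ E i := by
      refine ⟨configOf I H', (hWiff hA _).2 (by rwa [hHo]), z, fun e he => ?_, fun z' => ?_⟩
      · obtain ⟨⟨e, heG⟩, heI⟩ := e
        induction e with | h x y =>
        have hxy : x.1 ≠ z ∧ y.1 ≠ z := by
          simp only [J, Finset.mem_filter, Finset.mem_univ, true_and, not_exists, not_and] at he
          exact ⟨he x (Sym2.mem_mk_left x y), he y (Sym2.mem_mk_right x y)⟩
        have hS : x.1 ∈ S ∧ y.1 ∈ S := by simpa using mem_edgesWithin.1 heI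
        have h3 : η ⟨⟨s(x, y), heG⟩, heI⟩ = true ↔ H.Adj x y := by
          constructor
          · intro ho
            exact ⟨⟨heG, by simpa [extendClosed, heI] using ho⟩, hS.1, hS.2⟩
          · rintro ⟨⟨h4, h5⟩, -⟩
            simpa [extendClosed, heI] using h5
        rw [Bool.eq_iff_iff, h3, ← hoff x y hxy.1 hxy.2]
        simp [configOf]
      · change IsMarkedColumn (openWithin (extendClosed I (configOf I H')) S) _ _ _ _ _ _ _ _ ↔ _
        rw [hHo]
        exact hmark z'
    fin_cases i
    exacts [Or.inl hηE, Or.inr (Or.inl hηE), Or.inr (Or.inr hηE)]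
  have hu := weightOf_mono hp0.le hp1.le hcover
  have hu1 := weightOf_union_le hp0.le hp1.le (W A C) (E 0 ∪ (E 1 ∪ E 2))
  have hu2 := weightOf_union_le hp0.le hp1.le (E 0) (E 1 ∪ E 2)
  have hu3 := weightOf_union_le hp0.le hp1.le (E 1) (E 2)
  have he0 := hE 0
  have he1 := hE 1
  have he2 := hE 2
  linarith

/-- Since `t ≥ 4`, the factor 3 is absorbed by one more power of `t`, and the exponent of `CStar`
leaves ample room. -/
lemma gluing_constant_le (hd : 2 ≤ d) [NeZero k] {t : ℝ} (ht : 4 ≤ t) :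
    1 + 3 * t ^ columnBound d k ≤ 1 + t ^ (d * 7 ^ 2 * k ^ (d - 2)) := by
  have hk : 1 ≤ k ^ (d - 2) := Nat.one_le_pow _ _ (Nat.pos_of_ne_zero (NeZero.ne k))
  have hle : columnBound d k + 1 ≤ d * 7 ^ 2 * k ^ (d - 2) := by
    have h1 : 9 + (d - 2) * 2 + 1 ≤ d * 7 ^ 2 := by omega
    calc columnBound d k + 1 ≤ k ^ (d - 2) * (9 + (d - 2) * 2 + 1) := by
          rw [columnBound, mul_add _ _ 1]; omega
      _ ≤ k ^ (d - 2) * (d * 7 ^ 2) := Nat.mul_le_mul_left _ h1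
      _ = _ := mul_comm _ _
  have h2 : t ^ (columnBound d k + 1) ≤ t ^ (d * 7 ^ 2 * k ^ (d - 2)) :=
    pow_le_pow_right₀ (by linarith) hle
  have h3 : 0 ≤ t ^ columnBound d k := by positivity
  rw [pow_succ] at h2
  nlinarith

end Gluing
end SlabPercolation

namespace SlabPercolation

/-! ### Forced crossings by a discrete Jordan curve argument. -/

section Crossing

variable {d k : ℕ}

/-- The step from `u` to `v` crosses the vertical half-line just to the right of `c`, below `c`. -/
def StepBelow (c u v : ℤ × ℤ) : Prop :=
  ((u.1 = c.1 ∧ v.1 = c.1 + 1) ∨ (v.1 = c.1 ∧ u.1 = c.1 + 1)) ∧ u.2 < c.2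

open Classical in
/-- The parity of the number of steps of a walk below `c`. -/
noncomputable def crossParity (c : ℤ × ℤ) {x y : Slab d k} : (slabGraph d k).Walk x y → ZMod 2
  | .nil => 0
  | .cons (u := u) (v := v) _ p => (if StepBelow c u.1 v.1 then 1 else 0) + crossParity c p

lemma slabGraph_adj_fst {u v : Slab d k} (h : (slabGraph d k).Adj u v) :
    u.1 = v.1 ∨ (u.1.2 = v.1.2 ∧ (u.1.1 = v.1.1 + 1 ∨ v.1.1 = u.1.1 + 1)) ∨
      (u.1.1 = v.1.1 ∧ (u.1.2 = v.1.2 + 1 ∨ v.1.2 = u.1.2 + 1)) := by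
  rcases slabGraph_adj_cases h with ⟨-, h⟩ | ⟨h, -⟩
  · right
    rcases abs_cases (u.1.1 - v.1.1) with h1 | h1 <;>
      rcases abs_cases (u.1.2 - v.1.2) with h2 | h2 <;> omega
  · exact Or.inl h

lemma crossParity_congr {c c' : ℤ × ℤ} {x y : Slab d k} (p : (slabGraph d k).Walk x y)
    (h : ∀ u v : Slab d k, u ∈ p.support → v ∈ p.support → (slabGraph d k).Adj u v →
      (StepBelow c u.1 v.1 ↔ StepBelow c' u.1 v.1)) :
    crossParity c p = crossParity c' p := by
  classical
  induction p with
  | nil => rfl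
  | cons hadj p ih =>
    simp only [crossParity]
    rw [ih fun u v hu hv => h u v (by simp [hu]) (by simp [hv])]
    exact congrArg (· + _) (if_congr (h _ _ (by simp) (by simp) hadj) rfl rfl)

lemma crossParity_eq_zero {c : ℤ × ℤ} {x y : Slab d k} (p : (slabGraph d k).Walk x y)
    (h : ∀ u v : Slab d k, u ∈ p.support → v ∈ p.support → (slabGraph d k).Adj u v →
      ¬ StepBelow c u.1 v.1) :
    crossParity c p = 0 := by
  induction p with
  | nil => rfl
  | cons hadj p ih =>
    simp only [crossParity]
    rw [ih fun u v hu hv => h u v (by simp [hu]) (by simp [hv]),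
      if_neg (h _ _ (by simp) (by simp) hadj), add_zero]

open Classical in
/-- If the steps counted are those across the boundary of a set, only the ends matter. -/
lemma crossParity_add_eq {c c' : ℤ × ℤ} {x y : Slab d k} (p : (slabGraph d k).Walk x y)
    (P : ℤ × ℤ → Prop)
    (h : ∀ u v : Slab d k, u ∈ p.support → v ∈ p.support → (slabGraph d k).Adj u v →
      ((if StepBelow c u.1 v.1 then 1 else 0) + (if StepBelow c' u.1 v.1 then 1 else 0) : ZMod 2) =
        (if P u.1 then 1 else 0) + (if P v.1 then 1 else 0)) :
    crossParity c p + crossParity c' p = (if P x.1 then 1 else 0) + (if P y.1 then 1 else 0) := by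
  have h2 : ∀ a : ZMod 2, a + a = 0 := CharTwo.add_self_eq_zero
  induction p with
  | nil => simp [crossParity, h2]
  | @cons u v w hadj p ih =>
    have ih' := ih fun u v hu hv => h u v (by simp [hu]) (by simp [hv])
    have hs := h _ _ (by simp) (by simp) hadj
    simp only [crossParity]
    linear_combination hs + ih' + h2 (if P v.1 then 1 else 0)

/-- A vertical move of the base point changes the half-line by one place, which only a step touching
the lower of the two columns could cross, and `p` avoids it. For a horizontal move the two
half-lines bound a strip of width one, capped by an avoided column; the sum of the parities counts
passages in and out of the strip, and both ends of `p` lie outside it. -/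
lemma crossParity_eq_of_adj {x y s t : Slab d k} (p : (slabGraph d k).Walk x y)
    (hs : ∀ u ∈ p.support, u.1 ≠ s.1) (ht : ∀ u ∈ p.support, u.1 ≠ t.1)
    (hxs : x.1.1 ≤ s.1.1) (hxt : x.1.1 ≤ t.1.1)
    (hys : s.1.1 < y.1.1 ∨ s.1.2 ≤ y.1.2) (hyt : t.1.1 < y.1.1 ∨ t.1.2 ≤ y.1.2)
    (hst : (slabGraph d k).Adj s t) : crossParity s.1 p = crossParity t.1 p := by
  have hv : ∀ s t : Slab d k, (∀ u ∈ p.support, u.1 ≠ s.1) → (∀ u ∈ p.support, u.1 ≠ t.1) →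
      s.1.1 = t.1.1 → t.1.2 = s.1.2 + 1 → crossParity s.1 p = crossParity t.1 p := by
    intro s t hs ht h1 h2
    refine crossParity_congr p fun u v hu hv huv => ?_
    have := hs u hu
    have := hs v hv
    rcases slabGraph_adj_fst huv with h3 | h3 | h3 <;>
      simp only [StepBelow, Prod.ext_iff, ne_eq] at * <;> omega
  have hh : ∀ s t : Slab d k, (∀ u ∈ p.support, u.1 ≠ s.1) → (∀ u ∈ p.support, u.1 ≠ t.1) →
      x.1.1 ≤ s.1.1 → (t.1.1 < y.1.1 ∨ t.1.2 ≤ y.1.2) →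
      s.1.2 = t.1.2 → t.1.1 = s.1.1 + 1 → crossParity s.1 p = crossParity t.1 p := by
    classical
    intro s t hs ht hx hy h1 h2
    have := crossParity_add_eq (c := s.1) (c' := t.1) p
      (fun w => w.1 = s.1.1 + 1 ∧ w.2 < s.1.2) (by
        intro u v hu hv huv
        have h3 := ht u hu
        have h4 := ht v hv
        have h5 := slabGraph_adj_fst huv
        rw [ne_eq, Prod.ext_iff] at h3 h4
        rw [Prod.ext_iff] at h5
        by_cases k1 : StepBelow s.1 u.1 v.1 <;> by_cases k2 : StepBelow t.1 u.1 v.1 <;>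
          by_cases k3 : u.1.1 = s.1.1 + 1 ∧ u.1.2 < s.1.2 <;>
          by_cases k4 : v.1.1 = s.1.1 + 1 ∧ v.1.2 < s.1.2 <;>
          simp only [k1, k2, if_true, if_false] <;>
          (try rw [if_pos k3]) <;> (try rw [if_neg k3]) <;> (try rw [if_pos k4]) <;>
          (try rw [if_neg k4]) <;>
          first | rfl | (exfalso; simp only [StepBelow] at k1 k2; omega))
    have hx' : ¬ (x.1.1 = s.1.1 + 1 ∧ x.1.2 < s.1.2) := by omega
    have hy' : ¬ (y.1.1 = s.1.1 + 1 ∧ y.1.2 < s.1.2) := by omega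
    rw [if_neg hx', if_neg hy', add_zero] at this
    exact CharTwo.add_eq_zero.1 this
  rcases slabGraph_adj_fst hst with h | ⟨h1, h2 | h2⟩ | ⟨h1, h2 | h2⟩
  · rw [h]
  · exact (hh t s ht hs hxt hys h1.symm h2).symm
  · exact hh s t hs ht hxs hyt h1 h2
  · exact (hv t s ht hs h1.symm h2).symm
  · exact hv s t hs ht h1 h2

/-- The parity is constant along a walk that avoids the columns of `p`. -/
lemma crossParity_eq_of_walk {x y s t : Slab d k} (p : (slabGraph d k).Walk x y)
    (q : (slabGraph d k).Walk s t) (hpq : ∀ u ∈ p.support, ∀ v ∈ q.support, u.1 ≠ v.1)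
    (hx : ∀ v ∈ q.support, x.1.1 ≤ v.1.1)
    (hy : ∀ v ∈ q.support, v.1.1 < y.1.1 ∨ v.1.2 ≤ y.1.2) :
    crossParity s.1 p = crossParity t.1 p := by
  induction q with
  | nil => rfl
  | @cons s r t hadj q ih =>
    have hr : r ∈ (SimpleGraph.Walk.cons hadj q).support := by simp
    have hs : s ∈ (SimpleGraph.Walk.cons hadj q).support := by simp
    rw [crossParity_eq_of_adj p (fun u hu => hpq u hu s hs) (fun u hu => hpq u hu r hr) (hx s hs)
      (hx r hr) (hy s hs) (hy r hr) hadj]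
    exact ih (fun u hu v hv => hpq u hu v (by simp [hv])) (fun v hv => hx v (by simp [hv]))
      fun v hv => hy v (by simp [hv])

/-- If `p` stays weakly below `c`, the parity counts its crossings of a vertical line. -/
lemma crossParity_eq_one {c : ℤ × ℤ} {x y : Slab d k} (p : (slabGraph d k).Walk x y)
    (hc : ∀ u ∈ p.support, u.1 ≠ c) (hle : ∀ u ∈ p.support, u.1.2 ≤ c.2)
    (hx : x.1.1 ≤ c.1) (hy : c.1 < y.1.1) : crossParity c p = 1 := by
  classical
  have key : ∀ {x y : Slab d k} (p : (slabGraph d k).Walk x y),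
      (∀ u ∈ p.support, u.1 ≠ c) → (∀ u ∈ p.support, u.1.2 ≤ c.2) →
      crossParity c p = (if x.1.1 ≤ c.1 then 1 else 0) + (if y.1.1 ≤ c.1 then 1 else 0) := by
    intro x y p
    have h2 : ∀ a : ZMod 2, a + a = 0 := CharTwo.add_self_eq_zero
    induction p with
    | nil => intros; simp [crossParity, h2]
    | @cons u v w hadj p ih =>
      intro hc hle
      have ih' := ih (fun u hu => hc u (by simp [hu])) fun u hu => hle u (by simp [hu])
      have hu1 := hc u (by simp)
      have hu2 := hle u (by simp)
      have hv1 := hc v (by simp)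
      have hv2 := hle v (by simp)
      have h5 := slabGraph_adj_fst hadj
      -- A step across the vertical line at the height of `c` would touch `c`, so every crossing of
      -- the line happens strictly below and is counted.
      have hs : (if StepBelow c u.1 v.1 then 1 else 0 : ZMod 2) =
          (if u.1.1 ≤ c.1 then 1 else 0) + (if v.1.1 ≤ c.1 then 1 else 0) := by
        rw [ne_eq, Prod.ext_iff] at hu1 hv1
        rw [Prod.ext_iff] at h5
        by_cases k1 : StepBelow c u.1 v.1 <;> by_cases k2 : u.1.1 ≤ c.1 <;>
          by_cases k3 : v.1.1 ≤ c.1 <;> simp only [k1, k2, k3, if_true, if_false] <;>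
          first | rfl | (exfalso; simp only [StepBelow] at k1; omega)
      simp only [crossParity]
      linear_combination hs + ih' + h2 (if v.1.1 ≤ c.1 then 1 else 0)
  rw [key p hc hle, if_pos hx, if_neg (by omega), add_zero]

/-- The rectangle `[0, m) × [0, n)`. -/
noncomputable def rect (m n : ℕ) : Finset (ℤ × ℤ) := Finset.Ico 0 (m : ℤ) ×ˢ Finset.Ico 0 (n : ℤ)

lemma mem_rect {m n : ℕ} {z : ℤ × ℤ} :
    z ∈ rect m n ↔ (0 ≤ z.1 ∧ z.1 < m) ∧ 0 ≤ z.2 ∧ z.2 < n := by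
  simp [rect]

lemma slabWithin_le (S : Set (ℤ × ℤ)) : slabWithin d k S ≤ slabGraph d k := fun _ _ h => h.1

lemma mem_of_mem_support {S : Set (ℤ × ℤ)} {x y : Slab d k} (p : (slabWithin d k S).Walk x y)
    (hx : x.1 ∈ S) : ∀ v ∈ p.support, v.1 ∈ S := by
  classical
  intro v hv
  by_contra hvS
  obtain ⟨e, -, -, h2⟩ := (p.takeUntil v hv).exists_boundary_dart {w | w.1 ∈ S} hx hvS
  exact h2 e.adj.2.2

/-- Left-right paths cross paths from the top to the bottom, or to a lower point on the right. -/
lemma forcedCrossing_left_right_top_bottom {m n : ℕ} {T D : Set (ℤ × ℤ)}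
    (hT : ∀ z ∈ T, z ∈ rect m n ∧ z.2 = n - 1) (hD : ∀ z ∈ D, z.2 = 0) :
    ForcedCrossing d k (rect m n) {z | z ∈ rect m n ∧ z.1 = 0} {z | z ∈ rect m n ∧ z.1 = m - 1}
      T D fun z => z.2.toNat := by
  intro a b c e p q ha hb hc he
  by_contra! hcon
  have hp := mem_of_mem_support p ha.1
  have hq := mem_of_mem_support q (hT _ hc).1
  simp only [SetLike.mem_coe, mem_rect] at hp hq
  -- One extra step out of the rectangle puts the end of `p` strictly to the right of all of `q`.
  have hbadj : (slabGraph d k).Adj b ((b.1.1 + 1, b.1.2), b.2) := by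
    change l1dist _ _ = 1
    simp [l1dist]
  let p₁ := p.mapLe (slabWithin_le _)
  let p' := p₁.concat hbadj
  have hp' : ∀ u ∈ p'.support, u ∈ p.support ∨ u = ((b.1.1 + 1, b.1.2), b.2) := by
    intro u hu
    simpa [p', p₁, SimpleGraph.Walk.support_concat] using hu
  let q' := q.mapLe (slabWithin_le _)
  have hq' : ∀ v ∈ q'.support, v ∈ q.support := fun v hv => by simpa [q'] using hv
  have hb1 := hb.2
  have hb2 := hb.1
  have ha1 := ha.2
  have hc1 := hT _ hc
  simp only [mem_rect] at hb2 hc1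
  have hdis : ∀ u ∈ p'.support, ∀ v ∈ q.support, u.1 ≠ v.1 := by
    intro u hu v hv
    rcases hp' u hu with hu | rfl
    · exact hcon u hu v hv
    · have := hq v hv
      intro hh
      rw [← hh] at this
      simp only at this
      omega
  have hpar := crossParity_eq_of_walk p' q' (fun u hu v hv => hdis u hu v (hq' v hv))
    (fun v hv => by have := hq v (hq' v hv); omega)
    fun v hv => Or.inl (by have := hq v (hq' v hv); simp only; omega)
  -- Seen from `c` on the top row the parity is one. Seen from `e` it is zero: nothing lies below
  -- the bottom row, and on the right side the only step across the half-line's vertical line is the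
  -- extra one, at the height of `b`, above `e`.
  rw [crossParity_eq_one p' (fun u hu => hdis u hu c q.start_mem_support) (fun u hu => by
      rcases hp' u hu with hu | rfl
      · have := hp u hu; omega
      · simp only; omega) (by omega) (by simp only; omega),
    crossParity_eq_zero p' (fun u v hu hv huv hsb => by
      have hext : ∀ w ∈ p'.support, 0 ≤ w.1.2 ∧ (w.1.1 < m ∨ w.1.1 = m ∧ w.1.2 = b.1.2) := by
        intro w hw
        rcases hp' w hw with hw | rfl
        · have := hp w hw; omega
        · exact ⟨hb2.2.1, Or.inr ⟨by simp only; omega, rfl⟩⟩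
      have hu' := hext u hu
      have hv' := hext v hv
      have h5 := slabGraph_adj_fst huv
      rw [Prod.ext_iff] at h5
      simp only [StepBelow] at hsb
      rcases he with he | he
      · have := hD _ he; omega
      · have h6 := he.1.2
        have h7 := he.2
        simp only at h7
        omega)] at hpar
  exact one_ne_zero hpar

/-- Paths from the left to the top cross paths from the right to a top point further left. -/
lemma forcedCrossing_left_right_top {m n : ℕ} {T D : Set (ℤ × ℤ)}
    (hT : ∀ z ∈ T, z ∈ rect m n ∧ z.2 = n - 1) (hD : ∀ z ∈ D, z ∈ rect m n ∧ z.2 = n - 1)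
    (hTD : ∀ z ∈ T, ∀ z' ∈ D, z'.1 ≤ z.1) :
    ForcedCrossing d k (rect m n) {z | z ∈ rect m n ∧ z.1 = 0} T
      {z | z ∈ rect m n ∧ z.1 = m - 1} D fun z => z.1.toNat := by
  intro a b c e p q ha hb hc he
  by_contra! hcon
  have hp := mem_of_mem_support p ha.1
  have hq := mem_of_mem_support q hc.1
  simp only [SetLike.mem_coe, mem_rect] at hp hq
  let p' := p.mapLe (slabWithin_le _)
  let q' := q.mapLe (slabWithin_le _)
  have hp' : ∀ v ∈ p'.support, v ∈ p.support := fun v hv => by simpa [p'] using hv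
  have hq' : ∀ v ∈ q'.support, v ∈ q.support := fun v hv => by simpa [q'] using hv
  have ha1 := ha.2
  have hb1 := hT _ hb
  have hc1 := hc.2
  have he1 : e.1 ∈ rect m n ∧ e.1.2 = n - 1 ∧ e.1.1 ≤ b.1.1 := by
    rcases he with he | ⟨he, hlt⟩
    · exact ⟨(hD _ he).1, (hD _ he).2, hTD _ hb _ he⟩
    · have := hT _ he
      simp only at hlt
      exact ⟨this.1, this.2, by omega⟩
  have hne := hcon b p.end_mem_support e q.end_mem_support
  rw [ne_eq, Prod.ext_iff] at hne
  simp only [mem_rect] at he1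
  have hpar := crossParity_eq_of_walk p' q' (fun u hu v hv => hcon u (hp' u hu) v (hq' v hv))
    (fun v hv => by have := hq v (hq' v hv); omega)
    fun v hv => Or.inr (by have := hq v (hq' v hv); omega)
  -- From `e` on the top row, `p` starts weakly to the left and ends strictly to the right, so the
  -- parity is one. From `c` it is zero, since a counted step would leave the rectangle.
  rw [crossParity_eq_one (c := e.1) p' (fun u hu => hcon u (hp' u hu) e q.end_mem_support)
      (fun u hu => by have := hp u (hp' u hu); omega) (by omega) (by omega),
    crossParity_eq_zero (c := c.1) p' (fun u v hu hv huv hsb => by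
      have hu' := hp u (hp' u hu)
      have hv' := hp v (hp' v hv)
      simp only [StepBelow] at hsb
      omega)] at hpar
  exact zero_ne_one hpar

end Crossing
end SlabPercolation

namespace SlabPercolation

/-! ### Invariance under planar isometries and monotonicity in the length. -/

section Symmetry

variable {d k : ℕ}

lemma joinEvent_mono {X X' Y Y' S S' : Set (ℤ × ℤ)} (hX : X ⊆ X') (hY : Y ⊆ Y') (hS : S ⊆ S') :
    joinEvent d k X Y S ⊆ joinEvent d k X' Y' S' :=
  fun _ ⟨x, hx, y, hy, γ, hγ⟩ => ⟨x, hX hx, y, hY hy, γ, fun v hv => hS (hγ v hv)⟩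

lemma joinEvent_comm (X Y S : Set (ℤ × ℤ)) : joinEvent d k X Y S = joinEvent d k Y X S := by
  have : ∀ X Y, joinEvent d k X Y S ⊆ joinEvent d k Y X S :=
    fun _ _ _ ⟨x, hx, y, hy, γ, hγ⟩ => ⟨y, hy, x, hx, γ.reverse, fun v hv => hγ v (by simpa using hv)⟩
  exact (this X Y).antisymm (this Y X)

lemma joinEvent_union (X X' Y S : Set (ℤ × ℤ)) :
    joinEvent d k (X ∪ X') Y S = joinEvent d k X Y S ∪ joinEvent d k X' Y S := by
  ext ω
  constructor
  · rintro ⟨x, hx | hx, y, hy, γ, hγ⟩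
    exacts [Or.inl ⟨x, hx, y, hy, γ, hγ⟩, Or.inr ⟨x, hx, y, hy, γ, hγ⟩]
  · rintro (⟨x, hx, y, hy, γ, hγ⟩ | ⟨x, hx, y, hy, γ, hγ⟩)
    exacts [⟨x, Or.inl hx, y, hy, γ, hγ⟩, ⟨x, Or.inr hx, y, hy, γ, hγ⟩]

/-- The automorphism of the slab induced by an isometry of `ℤ²`. -/
def slabIso (d k : ℕ) (φ : ℤ × ℤ ≃ ℤ × ℤ)
    (hφ : ∀ z w, |(φ z).1 - (φ w).1| + |(φ z).2 - (φ w).2| = |z.1 - w.1| + |z.2 - w.2|) :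
    slabGraph d k ≃g slabGraph d k where
  toEquiv := φ.prodCongr (Equiv.refl _)
  map_rel_iff' := by
    intro x y
    change l1dist _ _ = 1 ↔ l1dist _ _ = 1
    simp [l1dist, hφ]

/-- Isometries of `ℤ²` preserve connection probabilities. -/
lemma bondMeasure_joinEvent_le (p : unitInterval) (φ : ℤ × ℤ ≃ ℤ × ℤ)
    (hφ : ∀ z w, |(φ z).1 - (φ w).1| + |(φ z).2 - (φ w).2| = |z.1 - w.1| + |z.2 - w.2|)
    {X X' Y Y' S S' : Set (ℤ × ℤ)} (hX : Set.MapsTo φ X X') (hY : Set.MapsTo φ Y Y')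
    (hS : Set.MapsTo φ S S') :
    (bondMeasure d k p).real (joinEvent d k X Y S) ≤
      (bondMeasure d k p).real (joinEvent d k X' Y' S') := by
  let Φ := slabIso d k φ hφ
  let e : (slabGraph d k).edgeSet ≃ (slabGraph d k).edgeSet := Φ.mapEdgeSet
  let T : Config d k ≃ᵐ Config d k := MeasurableEquiv.piCongrLeft (fun _ => Bool) e
  have hT : ∀ ω i, T ω (e i) = ω i := fun ω i => by
    simp [T, MeasurableEquiv.coe_piCongrLeft, Equiv.piCongrLeft_apply_apply]
  have hmap : (bondMeasure d k p).map T = bondMeasure d k p :=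
    Measure.infinitePi_map_piCongrLeft (μ := fun _ => bernoulliMeasure true false p) e
  have hsub : joinEvent d k X Y S ⊆ T ⁻¹' joinEvent d k X' Y' S' := by
    rintro ω ⟨x, hx, y, hy, γ, hγ⟩
    let f : openGraph ω →g openGraph (T ω) :=
      { toFun := Φ
        map_rel' := by
          rintro x y ⟨h1, h2⟩
          exact ⟨Φ.map_rel_iff.2 h1, (hT ω ⟨s(x, y), h1⟩).trans h2⟩ }
    refine ⟨Φ x, hX hx, Φ y, hY hy, γ.map f, fun v hv => ?_⟩
    rw [SimpleGraph.Walk.support_map] at hv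
    obtain ⟨w, hw, rfl⟩ := List.mem_map.1 hv
    exact hS (hγ w hw)
  calc (bondMeasure d k p).real (joinEvent d k X Y S)
      ≤ (bondMeasure d k p).real (T ⁻¹' joinEvent d k X' Y' S') := measureReal_mono hsub
    _ = ((bondMeasure d k p).map T).real (joinEvent d k X' Y' S') := by
        rw [measureReal_def, measureReal_def, T.map_apply]
    _ = _ := by rw [hmap]

lemma crossProb_eq [NeZero k] (m n : ℕ) :
    crossProb d k m n = (bondMeasure d k (pc d k)).real (joinEvent d k
      ({0} ×ˢ Set.Ico 0 (n : ℤ)) ({(m : ℤ) - 1} ×ˢ Set.Ico 0 (n : ℤ))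
      (Set.Ico 0 (m : ℤ) ×ˢ Set.Ico 0 (n : ℤ))) := rfl

lemma crossProb_nonneg [NeZero k] (m n : ℕ) : 0 ≤ crossProb d k m n := measureReal_nonneg

lemma crossProb_le_one [NeZero k] (m n : ℕ) : crossProb d k m n ≤ 1 := measureReal_le_one

/-- A walk reaching the half-plane `t ≤ x` contains an initial part that stays in `x ≤ t` and ends
on `x = t`. -/
lemma exists_walk_to_line {ω : Config d k} {x y : Slab d k} (γ : (openGraph ω).Walk x y) {t : ℤ}
    (hx : x.1.1 ≤ t) (hy : t ≤ y.1.1) :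
    ∃ z, ∃ δ : (openGraph ω).Walk x z, z.1.1 = t ∧
      ∀ v ∈ δ.support, v ∈ γ.support ∧ v.1.1 ≤ t := by
  induction γ with
  | nil => exact ⟨_, .nil, le_antisymm hx hy, by simpa using hx⟩
  | @cons u v w h γ ih =>
    rcases hx.eq_or_lt with hu | hu
    · exact ⟨u, .nil, hu, by simpa using hx⟩
    · have hv : v.1.1 ≤ t := by
        have := slabGraph_adj_fst h.1
        rw [Prod.ext_iff] at this
        omega
      obtain ⟨z, δ, hz, hδ⟩ := ih hv hy
      refine ⟨z, .cons h δ, hz, fun s hs => ?_⟩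
      rw [SimpleGraph.Walk.support_cons, List.mem_cons] at hs
      rcases hs with rfl | hs
      · exact ⟨by simp, hx⟩
      · exact ⟨by simp [(hδ s hs).1], (hδ s hs).2⟩

/-- A crossing of the longer rectangle, stopped when it first reaches the line x = m - 1, crosses
the shorter one. -/
lemma crossProb_antitone [NeZero k] {m m' n : ℕ} (hm : 1 ≤ m) (hmm : m ≤ m') :
    crossProb d k m' n ≤ crossProb d k m n := by
  refine measureReal_mono ?_
  rintro ω ⟨x, hx, y, hy, γ, hγ⟩
  have hx1 : x.1.1 = 0 := hx.1
  have hy1 : y.1.1 = m' - 1 := hy.1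
  obtain ⟨z, δ, hz, hδ⟩ := exists_walk_to_line γ (t := m - 1) (by omega) (by omega)
  refine ⟨x, hx, z, ⟨hz, (hγ z (hδ z δ.end_mem_support).1).2⟩, δ, fun v hv => ?_⟩
  have h1 := hγ v (hδ v hv).1
  have h2 := (hδ v hv).2
  exact ⟨⟨h1.1.1, by omega⟩, h1.2⟩

end Symmetry
end SlabPercolation

namespace SlabPercolation

/-! ### Longer rectangles and all aspect ratios. -/

section RSW

variable {d k : ℕ}

/-- The left side of a rectangle. -/
def rectLeft (m n : ℕ) : Set (ℤ × ℤ) := {z | z ∈ rect m n ∧ z.1 = 0}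

/-- The right side of a rectangle. -/
def rectRight (m n : ℕ) : Set (ℤ × ℤ) := {z | z ∈ rect m n ∧ z.1 = m - 1}

lemma crossProb_eq_rect [NeZero k] {m : ℕ} (hm : 1 ≤ m) (n : ℕ) :
    crossProb d k m n =
      (bondMeasure d k (pc d k)).real (joinEvent d k (rectLeft m n) (rectRight m n) (rect m n)) := by
  have hm' : (1 : ℤ) ≤ m := by exact_mod_cast hm
  have h1 : rectLeft m n = {0} ×ˢ Set.Ico 0 (n : ℤ) := by
    ext z
    simp only [rectLeft, Set.mem_ofPred_eq, mem_rect, Set.mem_prod, Set.mem_singleton_iff,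
      Set.mem_Ico]
    omega
  have h2 : rectRight m n = {(m : ℤ) - 1} ×ˢ Set.Ico 0 (n : ℤ) := by
    ext z
    simp only [rectRight, Set.mem_ofPred_eq, mem_rect, Set.mem_prod, Set.mem_singleton_iff,
      Set.mem_Ico]
    omega
  have h3 : (rect m n : Set (ℤ × ℤ)) = Set.Ico 0 (m : ℤ) ×ˢ Set.Ico 0 (n : ℤ) := by
    simp [rect]
  rw [crossProb_eq, h1, h2, h3]

/-- The square `[m - n, m) × [0, n)`. -/
def endSquare (m n : ℕ) : Set (ℤ × ℤ) :=
  {z | ((m : ℤ) - n ≤ z.1 ∧ z.1 < m) ∧ 0 ≤ z.2 ∧ z.2 < n}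

/-- The left half of the top of `endSquare m n`. -/
def topLeft (m n : ℕ) : Set (ℤ × ℤ) :=
  {z | z ∈ endSquare m n ∧ z.2 = n - 1 ∧ 2 * z.1 ≤ 2 * m - n - 1}

/-- The right half of the top of `endSquare m n`. -/
def topRight (m n : ℕ) : Set (ℤ × ℤ) :=
  {z | z ∈ endSquare m n ∧ z.2 = n - 1 ∧ 2 * m - n - 1 ≤ 2 * z.1}

/-- The bottom of `endSquare m n`. -/
def endBottom (m n : ℕ) : Set (ℤ × ℤ) := {z | z ∈ endSquare m n ∧ z.2 = 0}

/-- The reflection in the vertical axis of `endSquare m n`. -/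
def reflect (m n : ℕ) : ℤ × ℤ ≃ ℤ × ℤ :=
  (Equiv.subLeft (2 * (m : ℤ) - n - 1)).prodCongr (Equiv.refl ℤ)

lemma reflect_apply (m n : ℕ) (z : ℤ × ℤ) : reflect m n z = (2 * (m : ℤ) - n - 1 - z.1, z.2) := rfl

lemma reflect_isometry (m n : ℕ) (z w : ℤ × ℤ) :
    |(reflect m n z).1 - (reflect m n w).1| + |(reflect m n z).2 - (reflect m n w).2| =
      |z.1 - w.1| + |z.2 - w.2| := by
  simp only [reflect_apply]
  rw [abs_sub_comm z.1 w.1]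
  congr 2
  ring

/-- The isometry taking the left side of `[0, n)²` to the bottom of `endSquare m n`. -/
def rotate (m n : ℕ) : ℤ × ℤ ≃ ℤ × ℤ :=
  (Equiv.prodComm ℤ ℤ).trans ((Equiv.addLeft ((m : ℤ) - n)).prodCongr (Equiv.refl ℤ))

lemma rotate_apply (m n : ℕ) (z : ℤ × ℤ) : rotate m n z = ((m : ℤ) - n + z.2, z.1) := rfl

lemma rotate_isometry (m n : ℕ) (z w : ℤ × ℤ) :
    |(rotate m n z).1 - (rotate m n w).1| + |(rotate m n z).2 - (rotate m n w).2| =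
      |z.1 - w.1| + |z.2 - w.2| := by
  simp only [rotate_apply, add_sub_add_left_eq_sub]
  ring

/-- A crossing of the n × n square, turned to run between bottom and top of `endSquare`, ends in one
of two half-tops exchanged by `reflect`. The halves may share the midpoint, which is harmless for a
union bound. -/
lemma crossProb_le_two_mul_topRight [NeZero k] {m n : ℕ} (hn : 1 ≤ n) (hmn : n < m) :
    crossProb d k m n ≤ 2 * (bondMeasure d k (pc d k)).real
      (joinEvent d k (topRight m n) (endBottom m n) (endSquare m n)) := by
  have h1 : (bondMeasure d k (pc d k)).real
        (joinEvent d k (topLeft m n) (endBottom m n) (endSquare m n)) ≤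
      (bondMeasure d k (pc d k)).real
        (joinEvent d k (topRight m n) (endBottom m n) (endSquare m n)) := by
    refine bondMeasure_joinEvent_le _ (reflect m n) (reflect_isometry m n) ?_ ?_ ?_ <;>
    · intro z hz
      simp only [topLeft, topRight, endBottom, endSquare, Set.mem_ofPred_eq, reflect_apply] at hz ⊢
      omega
  calc crossProb d k m n ≤ crossProb d k n n := crossProb_antitone hn hmn.le
    _ = _ := crossProb_eq_rect hn n
    _ ≤ (bondMeasure d k (pc d k)).real
          (joinEvent d k (endBottom m n) (topLeft m n ∪ topRight m n) (endSquare m n)) := by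
        refine bondMeasure_joinEvent_le _ (rotate m n) (rotate_isometry m n) ?_ ?_ ?_ <;>
        · intro z hz
          simp only [topLeft, topRight, endBottom, endSquare, rectLeft, rectRight, SetLike.mem_coe,
            mem_rect, Set.mem_union, Set.mem_ofPred_eq, rotate_apply] at hz ⊢
          omega
    _ ≤ _ := by
        rw [joinEvent_comm, joinEvent_union, two_mul]
        exact (measureReal_union_le _ _).trans (add_le_add_left h1 _)

/-- Crossing a longer rectangle, when the parameter is nondegenerate. -/
lemma crossProb_rsw_of_pos [NeZero k] {m n : ℕ} (hn : 1 ≤ n) (hmn : n < m)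
    (h0 : 0 < pc d k) (h1 : pc d k < 1) {K : ℝ}
    (hK : 1 + 3 * (2 / min (pc d k : ℝ) (1 - pc d k)) ^ columnBound d k ≤ K) :
    crossProb d k m n ^ 4 / 4 ≤ K ^ 3 * crossProb d k (2 * m - n) n := by
  set M := 2 * m - n with hM
  have hMz : (M : ℤ) = 2 * m - n := by omega
  set P := (bondMeasure d k (pc d k)).real with hP
  set a := P (joinEvent d k (rectLeft m n) (topRight m n) (rect m n)) with ha
  have hnn : ∀ s, 0 ≤ P s := fun s => measureReal_nonneg
  have hmp : (0 : ℝ) < min (pc d k : ℝ) (1 - pc d k) :=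
    lt_min h0 (sub_pos.2 (show (pc d k : ℝ) < 1 from h1))
  have hK0 : 0 ≤ K := le_trans (by positivity) hK
  have hc := crossProb_nonneg (d := d) (k := k) m n
  -- Here the height on the right side `B` is the vertical coordinate; the vertical path costs the
  -- factor 2 from choosing a half-top.
  have hfirst : crossProb d k m n ^ 2 / 2 ≤ K * a := by
    have hg := glue (d := d) (k := k) (pc d k) h0 h1 (S := rect m n) (A := rectLeft m n)
      (B := rectRight m n) (C := topRight m n) (D := {z | z ∈ rect m n ∧ z.2 = 0})
      (h := fun z => z.2.toNat) (fun z hz => hz.1) (fun z hz => by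
        simp only [topRight, endSquare, Set.mem_ofPred_eq, SetLike.mem_coe, mem_rect] at hz ⊢
        omega) (fun z hz w hw hzw => by
        simp only [rectRight, Set.mem_ofPred_eq, mem_rect] at hz hw hzw
        exact Prod.ext (by omega) (by omega))
      (forcedCrossing_left_right_top_bottom (fun z hz => by
        simp only [topRight, endSquare, Set.mem_ofPred_eq, mem_rect] at hz ⊢
        omega) fun z hz => hz.2)
    rw [← crossProb_eq_rect (by omega)] at hg
    have hv : crossProb d k m n ≤ 2 * P (joinEvent d k (topRight m n)
        {z | z ∈ rect m n ∧ z.2 = 0} (rect m n)) := by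
      refine (crossProb_le_two_mul_topRight hn hmn).trans (mul_le_mul_of_nonneg_left
        (measureReal_mono (joinEvent_mono subset_rfl (fun z hz => ?_) fun z hz => ?_)) two_pos.le)
      all_goals
        simp only [endBottom, endSquare, Set.mem_ofPred_eq, SetLike.mem_coe, mem_rect] at hz ⊢
        omega
    have h3 := mul_le_mul_of_nonneg_left hv hc
    have h4 := mul_le_mul_of_nonneg_right hK (hnn
      (joinEvent d k (rectLeft m n) (topRight m n) (rect m n)))
    change crossProb d k m n * P _ ≤ _ * P _ at hg
    change _ * a ≤ K * a at h4
    change _ ≤ _ * a at hg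
    nlinarith
  -- The axis of `reflect` is also that of `rect M n`, so the second connection is the mirror image
  -- of the first. The height on `B = topRight` is now the horizontal coordinate.
  have hsecond : a ^ 2 ≤ K * crossProb d k M n := by
    have hg := glue (d := d) (k := k) (pc d k) h0 h1 (S := rect M n) (A := rectLeft M n)
      (B := topRight m n) (C := rectRight M n) (D := topLeft m n)
      (h := fun z => z.1.toNat) (fun z hz => hz.1) (fun z hz => hz.1) (fun z hz w hw hzw => by
        simp only [topRight, endSquare, Set.mem_ofPred_eq] at hz hw hzw
        exact Prod.ext (by omega) (by omega))
      (forcedCrossing_left_right_top (fun z hz => by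
        simp only [topRight, endSquare, Set.mem_ofPred_eq, mem_rect] at hz ⊢
        omega) (fun z hz => by
        simp only [topLeft, endSquare, Set.mem_ofPred_eq, mem_rect] at hz ⊢
        omega) fun z hz z' hz' => by
        simp only [topRight, topLeft, Set.mem_ofPred_eq] at hz hz'
        omega)
    rw [← crossProb_eq_rect (by omega)] at hg
    have h2 : a ≤ P (joinEvent d k (rectLeft M n) (topRight m n) (rect M n)) := by
      refine measureReal_mono (joinEvent_mono (fun z hz => ?_) subset_rfl fun z hz => ?_)
      all_goals
        simp only [rectLeft, Set.mem_ofPred_eq, SetLike.mem_coe, mem_rect] at hz ⊢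
        omega
    have h3 : a ≤ P (joinEvent d k (rectRight M n) (topLeft m n) (rect M n)) := by
      refine bondMeasure_joinEvent_le _ (reflect m n) (reflect_isometry m n) ?_ ?_ ?_ <;>
      · intro z hz
        simp only [topLeft, topRight, endSquare, rectLeft, rectRight, SetLike.mem_coe, mem_rect,
          Set.mem_ofPred_eq, reflect_apply] at hz ⊢
        omega
    have h4 := mul_le_mul_of_nonneg_right hK (crossProb_nonneg (d := d) (k := k) M n)
    have h5 := mul_le_mul h2 h3 (hnn _) (hnn _)
    calc a ^ 2 = a * a := sq a
      _ ≤ _ := h5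
      _ ≤ _ := hg
      _ ≤ _ := h4
  calc crossProb d k m n ^ 4 / 4 = (crossProb d k m n ^ 2 / 2) ^ 2 := by ring
    _ ≤ (K * a) ^ 2 := pow_le_pow_left₀ (by positivity) hfirst 2
    _ = K ^ 2 * a ^ 2 := by ring
    _ ≤ K ^ 2 * (K * crossProb d k M n) := mul_le_mul_of_nonneg_left hsecond (by positivity)
    _ = _ := by ring

lemma bondMeasure_zero : bondMeasure d k 0 = Measure.dirac fun _ => false := by
  simp only [bondMeasure, bernoulliMeasure_zero]
  exact Measure.infinitePi_dirac _

lemma bondMeasure_one : bondMeasure d k 1 = Measure.dirac fun _ => true := by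
  simp only [bondMeasure, bernoulliMeasure_one]
  exact Measure.infinitePi_dirac _

/-- All edges are closed almost surely, and for `m ≥ 2` the two sides are disjoint, so a trivial
path cannot cross. -/
lemma crossProb_of_pc_eq_zero [NeZero k] (h : pc d k = 0) {m n : ℕ} (hm : 2 ≤ m) :
    crossProb d k m n = 0 := by
  rw [crossProb, h, bondMeasure_zero, measureReal_def, Measure.dirac_apply, Set.indicator_of_notMem,
    ENNReal.toReal_zero]
  rintro ⟨x, hx, y, hy, γ, -⟩
  cases γ with
  | nil =>
    have h1 : x.1.1 = 0 := hx.1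
    have h2 : x.1.1 = m - 1 := hy.1
    omega
  | cons hadj _ =>
    obtain ⟨_, h2⟩ := hadj
    simp at h2

lemma crossProb_of_pc_eq_one [NeZero k] (h : pc d k = 1) {m n : ℕ} (hm : 1 ≤ m) (hn : 1 ≤ n) :
    crossProb d k m n = 1 := by
  rw [crossProb, h, bondMeasure_one, measureReal_def, Measure.dirac_apply_of_mem,
    ENNReal.toReal_one]
  have hwalk : ∀ j : ℕ, ∃ γ : (openGraph (fun _ => true : Config d k)).Walk (0, 0) ((j, 0), 0),
      ∀ v ∈ γ.support, v.1.2 = 0 ∧ 0 ≤ v.1.1 ∧ v.1.1 ≤ j := by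
    intro j
    induction j with
    | zero => exact ⟨.nil, by simp⟩
    | succ j ih =>
      obtain ⟨γ, hγ⟩ := ih
      have hadj : (openGraph (fun _ => true : Config d k)).Adj ((j, 0), 0) (((j + 1 : ℕ), 0), 0) :=
        ⟨by change l1dist _ _ = 1; simp [l1dist], rfl⟩
      refine ⟨γ.concat hadj, fun v hv => ?_⟩
      rw [SimpleGraph.Walk.support_concat, List.mem_append, List.mem_singleton] at hv
      rcases hv with hv | rfl
      · have := hγ v hv
        push_cast
        omega
      · simp only [true_and]
        omega
  obtain ⟨γ, hγ⟩ := hwalk (m - 1)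
  have hn' : (0 : ℤ) < n := by exact_mod_cast hn
  refine ⟨_, ⟨Set.mem_singleton _, le_rfl, hn'⟩, _, ⟨?_, le_rfl, hn'⟩, γ, fun v hv => ?_⟩
  · change ((m - 1 : ℕ) : ℤ) = m - 1
    omega
  · have := hγ v hv
    exact ⟨⟨this.2.1, by omega⟩, by omega, by omega⟩

lemma crossProb_zero_height [NeZero k] (m : ℕ) : crossProb d k m 0 = 0 := by
  have : LR d k m 0 = ∅ := by
    ext ω
    refine iff_of_false ?_ id
    rintro ⟨x, hx, -⟩
    exact absurd hx.2 (by simp)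
  simp [crossProb, this]

lemma CStar_nonneg [NeZero k] : 0 ≤ CStar d k :=
  pow_nonneg (div_nonneg two_pos.le (le_min (pc d k).2.1 (sub_nonneg.2 (pc d k).2.2))) _

lemma cStar_pos [NeZero k] : 0 < cStar d k :=
  one_div_pos.2 (by have := CStar_nonneg (d := d) (k := k); linarith)

lemma cStar_le_one [NeZero k] : cStar d k ≤ 1 := by
  have := CStar_nonneg (d := d) (k := k)
  rw [cStar, div_le_one (by linarith)]
  linarith

/-- The crossing probability of a longer rectangle. -/
theorem crossProb_rsw [NeZero k] (hd : 2 ≤ d) {m n : ℕ} (hmn : n < m) :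
    1 / 4 * cStar d k ^ 3 * crossProb d k m n ^ 4 ≤ crossProb d k (2 * m - n) n := by
  rcases Nat.eq_zero_or_pos n with rfl | hn
  · simp [crossProb_zero_height]
  -- Surgery needs a parameter strictly between 0 and 1; at the endpoints `2 / 0 = 0` makes `CStar`
  -- meaningless, and crossings are computed directly.
  rcases eq_or_ne (pc d k) 0 with h0 | h0
  · rw [crossProb_of_pc_eq_zero h0 (by omega)]
    simpa using crossProb_nonneg _ _
  rcases eq_or_ne (pc d k) 1 with h1 | h1
  · rw [crossProb_of_pc_eq_one h1 (m := 2 * m - n) (by omega) hn]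
    have h2 : cStar d k ^ 3 ≤ 1 := pow_le_one₀ cStar_pos.le cStar_le_one
    have h3 : crossProb d k m n ^ 4 ≤ 1 := pow_le_one₀ (crossProb_nonneg _ _) (crossProb_le_one _ _)
    have h4 : 0 ≤ cStar d k ^ 3 := pow_nonneg cStar_pos.le 3
    have h5 := mul_le_one₀ h2 (pow_nonneg (crossProb_nonneg m n) 4) h3
    linarith
  have h0' : 0 < pc d k := lt_of_le_of_ne (pc d k).2.1 h0.symm
  have h1' : pc d k < 1 := lt_of_le_of_ne (pc d k).2.2 h1
  have hp0 : (0 : ℝ) < pc d k := h0'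
  have hp1 : (pc d k : ℝ) < 1 := h1'
  have hm0 : 0 < min (pc d k : ℝ) (1 - pc d k) := lt_min hp0 (by linarith)
  -- This makes `2 / min` at least 4, as `gluing_constant_le` requires.
  have hm1 : min (pc d k : ℝ) (1 - pc d k) ≤ 1 / 2 := by
    rcases le_total (pc d k : ℝ) (1 / 2) with h | h
    · exact (min_le_left _ _).trans h
    · exact (min_le_right _ _).trans (by linarith)
  have hr := crossProb_rsw_of_pos hn hmn h0' h1' (gluing_constant_le (k := k) hd
    (t := 2 / min (pc d k : ℝ) (1 - pc d k)) ((le_div_iff₀ hm0).2 (by linarith)))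
  change _ ≤ (1 + CStar d k) ^ 3 * _ at hr
  have hC : 0 < 1 + CStar d k := by have := CStar_nonneg (d := d) (k := k); linarith
  have hmul : cStar d k ^ 3 * (1 + CStar d k) ^ 3 = 1 := by
    rw [← mul_pow, cStar, one_div_mul_cancel hC.ne', one_pow]
  calc 1 / 4 * cStar d k ^ 3 * crossProb d k m n ^ 4
      = cStar d k ^ 3 * (crossProb d k m n ^ 4 / 4) := by ring
    _ ≤ cStar d k ^ 3 * ((1 + CStar d k) ^ 3 * crossProb d k (2 * m - n) n) :=
        mul_le_mul_of_nonneg_left hr (pow_nonneg cStar_pos.le 3)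
    _ = _ := by rw [← mul_assoc, hmul, one_mul]

/-- The crossing probabilities with aspect ratio `ρ` are eventually bounded below. -/
def CrossingBounded (d k : ℕ) [NeZero k] (ρ : ℝ) : Prop :=
  ∃ ε > 0, ∀ᶠ n : ℕ in Filter.atTop, ε ≤ crossProb d k ⌊ρ * n⌋₊ n

/-- The liminf is taken in `ℝ`, so both directions need the bounds 0 and 1 on the probabilities. -/
lemma crossingBounded_iff [NeZero k] (ρ : ℝ) : CrossingBounded d k ρ ↔
    0 < Filter.liminf (fun n : ℕ => crossProb d k ⌊ρ * n⌋₊ n) Filter.atTop := by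
  have hb : Filter.IsBoundedUnder (· ≥ ·) Filter.atTop
      (fun n : ℕ => crossProb d k ⌊ρ * n⌋₊ n) :=
    Filter.isBoundedUnder_of ⟨0, fun n => crossProb_nonneg _ _⟩
  have hcb : Filter.IsCoboundedUnder (· ≥ ·) Filter.atTop
      (fun n : ℕ => crossProb d k ⌊ρ * n⌋₊ n) :=
    (Filter.isBoundedUnder_of ⟨1, fun n => crossProb_le_one _ _⟩).isCoboundedUnder_ge
  constructor
  · rintro ⟨ε, hε, h⟩
    exact hε.trans_le (Filter.le_liminf_of_le hcb h)
  · intro h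
    obtain ⟨ε, h1, h2⟩ := exists_between h
    exact ⟨ε, h1, (Filter.eventually_lt_of_lt_liminf h2 hb).mono fun _ hn => hn.le⟩

lemma CrossingBounded.mono [NeZero k] {ρ ρ' : ℝ} (h1 : 1 < ρ') (hle : ρ' ≤ ρ)
    (h : CrossingBounded d k ρ) : CrossingBounded d k ρ' := by
  obtain ⟨ε, hε, h⟩ := h
  refine ⟨ε, hε, ?_⟩
  filter_upwards [h, Filter.eventually_ge_atTop 1] with n hn hn1
  have hn1' : (1 : ℝ) ≤ n := by exact_mod_cast hn1
  refine hn.trans (crossProb_antitone ?_ (Nat.floor_mono (by gcongr)))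
  exact Nat.le_floor (by push_cast; nlinarith)

lemma CrossingBounded.step [NeZero k] (hd : 2 ≤ d) {ρ : ℝ} (h1 : 1 < ρ)
    (h : CrossingBounded d k ρ) : CrossingBounded d k (1 + 3 / 2 * (ρ - 1)) := by
  obtain ⟨ε, hε, h⟩ := h
  refine ⟨1 / 4 * cStar d k ^ 3 * ε ^ 4, by have := cStar_pos (d := d) (k := k); positivity, ?_⟩
  -- Without rounding the excess `ρ - 1` would double; rounding down loses less than 2 in `2 * ⌊ρ *
  -- n⌋₊ - n`. Asking only for the factor 3/2 leaves `n * (ρ - 1) / 2 ≥ 3` to cover this.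
  filter_upwards [h, Filter.eventually_ge_atTop ⌈6 / (ρ - 1)⌉₊] with n hn hn1
  have hρ : 0 < ρ - 1 := by linarith
  have hn2 : 6 ≤ (n : ℝ) * (ρ - 1) := (div_le_iff₀ hρ).1 (Nat.ceil_le.1 hn1)
  have hn0 : (0 : ℝ) ≤ n := n.cast_nonneg
  have hfl := Nat.lt_floor_add_one (ρ * n)
  have hmn : n < ⌊ρ * n⌋₊ := by
    have : (n : ℝ) < ⌊ρ * n⌋₊ := by nlinarith
    exact_mod_cast this
  calc 1 / 4 * cStar d k ^ 3 * ε ^ 4 ≤ 1 / 4 * cStar d k ^ 3 * crossProb d k ⌊ρ * n⌋₊ n ^ 4 := by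
        have := cStar_pos (d := d) (k := k)
        gcongr
    _ ≤ crossProb d k (2 * ⌊ρ * n⌋₊ - n) n := crossProb_rsw hd hmn
    _ ≤ _ := by
        refine crossProb_antitone (Nat.le_floor ?_) (Nat.floor_le_of_le ?_)
        · push_cast
          nlinarith
        · rw [Nat.cast_sub (by omega)]
          push_cast
          nlinarith

lemma CrossingBounded.all [NeZero k] (hd : 2 ≤ d) {ρ : ℝ} (h1 : 1 < ρ)
    (h : CrossingBounded d k ρ) {ρ' : ℝ} (h1' : 1 < ρ') : CrossingBounded d k ρ' := by
  have hpow : ∀ j : ℕ, CrossingBounded d k (1 + (3 / 2) ^ j * (ρ - 1)) := by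
    intro j
    induction j with
    | zero => simpa using h
    | succ j ih =>
      have hpos : 0 < (3 / 2 : ℝ) ^ j * (ρ - 1) := mul_pos (by positivity) (by linarith)
      have := ih.step hd (by linarith)
      convert this using 1
      ring
  obtain ⟨j, hj⟩ := pow_unbounded_of_one_lt ((ρ' - 1) / (ρ - 1)) (by norm_num : (1 : ℝ) < 3 / 2)
  refine (hpow j).mono h1' ?_
  rw [div_lt_iff₀ (by linarith)] at hj
  linarith

end RSW
end SlabPercolation

theorem mainTheorem3 (d k : ℕ) [NeZero k] (hd : 2 ≤ d) (hk : 2 ≤ k) :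
    (∀ m n : ℕ, n < m →
      SlabPercolation.crossProb d k (2 * m - n) n ≥
        1 / 4 * SlabPercolation.cStar d k ^ 3 * SlabPercolation.crossProb d k m n ^ 4) ∧
    ((∃ ρ : ℝ, 1 < ρ ∧
        0 < Filter.liminf (fun n : ℕ => SlabPercolation.crossProb d k ⌊ρ * n⌋₊ n) Filter.atTop) →
      ∀ ρ : ℝ, 1 < ρ →
        0 < Filter.liminf (fun n : ℕ => SlabPercolation.crossProb d k ⌊ρ * n⌋₊ n)
          Filter.atTop) := by
  refine ⟨fun m n hmn => SlabPercolation.crossProb_rsw hd hmn, fun ⟨ρ, hρ, h⟩ ρ' hρ' => ?_⟩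
  rw [← SlabPercolation.crossingBounded_iff] at h ⊢
  exact h.all hd hρ hρ'
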